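/- Let $M$ be $\mathbb R$, $I=[-1,1]$ or the circle $\mathbb T^1=\mathbb R/\mathbb Z$, and let $f:M\to M$ be of class $C^2$; if $M=I$, assume moreover that for some $a>0$ the map $f$ is of class $C^2$ on $[-1-a,1+a]$ and $f([-1-a,1+a])\subset[-1,1]$. Let $p>2$ and let $(\xi_n)$ be independent random variables on a probability space $(\Omega,\mathcal F,\mathbb P)$ with $\mathbb E[\xi_n]=0$ and $c\le\|\xi_n\|_2\le\|\xi_n\|_p\le C$ for all $n$, for some constants $c>0$ and $C$, where $\|X\|_s=(\mathbb E|X|^s)^{1/s}$. For $x\in M$, $\sigma>0$ and $n\ge1$ put $$\Lambda_s(x,n)=\sum_{j=1}^n\bigl|(f^{n-j})'(f^j(x))\bigr|^s,\qquad \widehat\Lambda(x,n)=\max_{0\le i\le n}\sum_{j=0}^i\bigl|(f^{i-j})'(f^j(x))\bigr|,$$ $$L_n(x)=\sum_{j=1}^n (f^{n-j})'(f^j(x))\,\xi_j,\qquad \|f''\|=\sup_{y\in M}|f''(y)|,$$ let $x_0=x$, $x_m=f(x_{m-1})+\sigma\xi_m$, and let $$w_n(x,\sigma)=\frac{x_n-f^n(x)}{\sigma\sqrt{\operatorname{Var}[L_n(x)]}}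 .$$ (For $M=\mathbb T^1$, derivatives and the difference $x_n-f^n(x)$ are computed with a lift of $f$ to $\mathbb R$.) Let $$B(x,\sigma,n)=\Bigl\{\|f''\|\,\sigma\,\widehat\Lambda(x,n)^2\max_{1\le j\le n}|\xi_j|\le\tfrac14\Bigr\},$$ intersected, if $M=I$, with the event $\{\sigma\max_{1\le j\le n}|\xi_j|\le a\}$, on which $x_1,\dots,x_n$ are well defined. Let $s=\min(p,3)$ and let $\Phi$ be the distribution function of the standard Gaussian. Then for every $x\in M$ there is a constant $A>0$ (which may depend on $f$, the noise and $x$, but on none of the sequences below) such that the following holds. Let $(n_k)$ be an increasing sequence of positive integers with $$\lim_{k\to\infty}\frac{\Lambda_p(x,n_k)}{\Lambda_2(x,n_k)^{p/2}}=0,$$ and let $(\sigma_k)$ be a sequence of positive numbers such that for all $k$ $$\frac{\widehat\Lambda(x,n_k)^3}{\sqrt{\operatorname{Var}[L_{n_k}(x)]}}\,\|f''\|\,\Bigl\|\max_{1\le j\le n_k}|\xi_j|\Bigr\|_s^2\,\sigma_k\le\left(\frac{\Lambda_s(x,n_k)}{\Lambda_2(x,n_k)^{s/2}}\right)^2 .$$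 Then the events $B_k=B(x,\sigma_k,n_k)$ satisfy $\lim_{k\to\infty}\mathbb P[B_k]=1$ and, for all $k$, $$\sup_{z\in\mathbb R}\Bigl|\mathbb P\bigl[w_{n_k}(x,\sigma_k)\mathbf 1_{B_k}\le z\bigr]-\Phi(z)\Bigr|\le A\,\frac{\Lambda_s(x,n_k)}{\Lambda_2(x,n_k)^{s/2}} .$$ -/

import Mathlib

open MeasureTheory ProbabilityTheory Filter Topology
open scoped ENNReal NNReal

noncomputable section

/-- A `C²` map `f : M → M` of a one-dimensional phase space `M`, where `M` is the real line,
the interval `[-1, 1]` or the circle `ℝ / ℤ`.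

* `line`: `f` is a `C²` map of the line.
* `interval`: `f` is of class `C²` on the larger interval `[-1 - a, 1 + a]`, `a > 0`, and maps it
  into `[-1, 1]`. (The values of the function `f : ℝ → ℝ` outside `[-1 - a, 1 + a]` play no role.)
* `circle`: `f` is a self-map of `ℝ / ℤ` with a `C²` lift `F : ℝ → ℝ`. -/
inductive OneDimMap : Type
  | line (f : ℝ → ℝ) (contDiff : ContDiff ℝ 2 f)
  | interval (a : ℝ) (a_pos : 0 < a) (f : ℝ → ℝ)
      (contDiffOn : ContDiffOn ℝ 2 f (Set.Icc (-1 - a) (1 + a)))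
      (mapsTo : Set.MapsTo f (Set.Icc (-1 - a) (1 + a)) (Set.Icc (-1) 1))
  | circle (f : UnitAddCircle → UnitAddCircle) (F : ℝ → ℝ) (contDiff : ContDiff ℝ 2 F)
      (lift : ∀ t : ℝ, ((F t : ℝ) : UnitAddCircle) = f (t : UnitAddCircle))

namespace OneDimMap

/-- The map in the real coordinate of the phase space: `f` itself on the line and the interval,
the lift of `f` on the circle. -/
def toFun : OneDimMap → ℝ → ℝ
  | line f _ => f
  | interval _ _ f _ _ => f
  | circle _ F _ _ => F

/-- The real coordinates of the points of `M`. On the circle every real number `t` is a coordinate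
of the point `t mod 1`. -/
def domain : OneDimMap → Set ℝ
  | line _ _ => Set.univ
  | interval _ _ _ _ _ => Set.Icc (-1) 1
  | circle _ _ _ _ => Set.univ

/-- `‖f''‖ = sup_{y ∈ M} |f''(y)|`, an extended nonnegative real. -/
def secondDerivNorm (S : OneDimMap) : ℝ≥0∞ :=
  ⨆ y ∈ S.domain, ENNReal.ofReal |deriv (deriv S.toFun) y|

/-- The Lyapunov functions `Λ_s(x,n) = ∑_{j=1}^n |(f^{n-j})' (f^j x)|^s`. -/
def lyapunov (S : OneDimMap) (s x : ℝ) (n : ℕ) : ℝ :=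
  ∑ j ∈ Finset.Icc 1 n, |deriv (S.toFun^[n - j]) (S.toFun^[j] x)| ^ s

/-- `Λ̂(x,n) = max_{0 ≤ i ≤ n} ∑_{j=0}^i |(f^{i-j})' (f^j x)|`. -/
def lyapunovHat (S : OneDimMap) (x : ℝ) (n : ℕ) : ℝ :=
  (Finset.range (n + 1)).sup' ⟨0, by simp⟩ fun i =>
    ∑ j ∈ Finset.range (i + 1), |deriv (S.toFun^[i - j]) (S.toFun^[j] x)|

variable {Ω : Type*}

/-- The linearized effective noise `L_n(x) = ∑_{j=1}^n (f^{n-j})' (f^j x) ξ_j`. -/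
def linearNoise (S : OneDimMap) (ξ : ℕ → Ω → ℝ) (x : ℝ) (n : ℕ) (ω : Ω) : ℝ :=
  ∑ j ∈ Finset.Icc 1 n, deriv (S.toFun^[n - j]) (S.toFun^[j] x) * ξ j ω

/-- The noisy orbit `x_0 = x`, `x_m = f(x_{m-1}) + σ ξ_m`, in the real coordinate. -/
def noisyOrbit (S : OneDimMap) (ξ : ℕ → Ω → ℝ) (x σ : ℝ) : ℕ → Ω → ℝ
  | 0, _ => x
  | m + 1, ω => S.toFun (noisyOrbit S ξ x σ m ω) + σ * ξ (m + 1) ω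

/-- The normalized noise `w_n(x,σ) = (x_n(x,σ) - f^n(x)) / (σ √Var[L_n(x)])`. -/
def normalizedNoise [MeasurableSpace Ω] (S : OneDimMap) (P : Measure Ω) (ξ : ℕ → Ω → ℝ)
    (x σ : ℝ) (n : ℕ) (ω : Ω) : ℝ :=
  (S.noisyOrbit ξ x σ n ω - S.toFun^[n] x) / (σ * √(Var[S.linearNoise ξ x n; P]))

end OneDimMap

variable {Ω : Type*}

/-- `max_{1 ≤ j ≤ n} |ξ_j|`. -/
def maxNoise (ξ : ℕ → Ω → ℝ) (n : ℕ) (ω : Ω) : ℝ :=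
  ((Finset.Icc 1 n).sup fun j => ‖ξ j ω‖₊ : ℝ≥0)

/-- `‖X‖_s = (E |X|^s)^{1/s}`. -/
def momentNorm [MeasurableSpace Ω] (P : Measure Ω) (s : ℝ) (X : Ω → ℝ) : ℝ :=
  (∫ ω, |X ω| ^ s ∂P) ^ (1 / s)

/-- The standing assumption on the noise: the `ξ_n` are independent random variables with finite
moments of order `p`, with mean zero, and `c ≤ ‖ξ_n‖_2 ≤ ‖ξ_n‖_p ≤ C` for some constants
`0 < c` and `C`. -/
structure IsNoise [MeasurableSpace Ω] (P : Measure Ω) (ξ : ℕ → Ω → ℝ) (p : ℝ) : Prop where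
  measurable : ∀ n, Measurable (ξ n)
  indep : iIndepFun ξ P
  memLp : ∀ n, MemLp (ξ n) (ENNReal.ofReal p) P
  mean_zero : ∀ n, ∫ ω, ξ n ω ∂P = 0
  moments : ∃ c C : ℝ, 0 < c ∧ ∀ n, c ≤ momentNorm P 2 (ξ n) ∧
    momentNorm P 2 (ξ n) ≤ momentNorm P p (ξ n) ∧ momentNorm P p (ξ n) ≤ C

namespace OneDimMap

/-- For `M = [-1, 1]`, the event `{σ max_{1 ≤ j ≤ n} |ξ_j| ≤ a}`, on which the noisy orbit stays in
`[-1 - a, 1 + a]` up to time `n`; the whole space for the line and the circle. -/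
def staysInside (S : OneDimMap) (ξ : ℕ → Ω → ℝ) (σ : ℝ) (n : ℕ) : Set Ω :=
  match S with
  | line _ _ => Set.univ
  | interval a _ _ _ _ => {ω | σ * maxNoise ξ n ω ≤ a}
  | circle _ _ _ _ => Set.univ

/-- The complement of the outliers:
`B = {‖f''‖ σ Λ̂(x,n)² max_{1 ≤ j ≤ n} |ξ_j| ≤ 1/4}`, intersected for `M = [-1, 1]` with the event
`{σ max_{1 ≤ j ≤ n} |ξ_j| ≤ a}`. -/
def goodEvent (S : OneDimMap) (ξ : ℕ → Ω → ℝ) (x σ : ℝ) (n : ℕ) : Set Ω :=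
  {ω | S.secondDerivNorm * ENNReal.ofReal (σ * S.lyapunovHat x n ^ 2 * maxNoise ξ n ω) ≤ 1 / 4}
    ∩ S.staysInside ξ σ n

/-- The ratio `Λ_s(x,n) / Λ_2(x,n)^{s/2}`. -/
def lyapunovRatio (S : OneDimMap) (s x : ℝ) (n : ℕ) : ℝ :=
  S.lyapunov s x n / S.lyapunov 2 x n ^ (s / 2)

end OneDimMap

end

/-! Write `R` for the ratio Λ_s/Λ_2^{s/2} and η for the maximum of the noise up to time n. The
normalized deviation w_n is a normalized sum of independent variables plus a quadratic error, and
both the distance of the sum from the Gaussian and the effect of the error are O(`R`).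

Linear part. Dividing the coefficients of L_n by √Λ_2 makes their squares sum to one and the sum of
their s-th powers equal to `R`. The Berry–Esseen inequality `BerryEsseen.berry_esseen` has error ∑
E[X² min(1,|X|)], and this is at most ∑ E|X|^s for 2 ≤ s ≤ 3; hence s = min(p,3). It is proved by
Stein's method: the half-line Stein solution is bounded and Lipschitz, and its derivative jumps only
at z. The jump is harmless because the sum without one term rarely falls in a short interval around
z (`concentration`).

Error. The deviation of the noisy orbit satisfies the linearized recursion driven by σξ and a Taylor
remainder. Variation of constants and a bootstrap (`OrbitError.abs_deviation_sub_le`) give w_n =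
L_n/√Var + O(h η²), with h = ‖f''‖ σ Λ̂³/√Var. The smallness hypothesis says h‖η‖_s² ≤ `R`², so by
Markov h η² is O(`R`) outside a set of probability O(`R`). As √Var = O(Λ̂), the number ‖f''‖ σ Λ̂²
is O(h), so a second Markov bound puts the complement of the good event into a set of the same
order. Since Φ is 1-Lipschitz, replacing w_n by L_n/√Var then costs O(`R`). Finally, `R` tends to 0
along the sequence, which gives P[B_k] → 1.

Degenerate cases. If ‖f''‖ = ∞, the smallness hypothesis fails. On the interval, noisy orbits may
leave [-1,1], where ‖f''‖ says nothing; by compactness the Taylor constant is still a multiple of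
‖f''‖ when ‖f''‖ > 0. When ‖f''‖ = 0 the map is affine on [-1,1] with slope of modulus less than
one, so Λ_2 stays bounded and the limit hypothesis fails. -/

/-! ### The standard Gaussian distribution function -/

namespace SteinGaussian

/-- The distribution function of the standard Gaussian. -/
noncomputable def Phi (w : ℝ) : ℝ := cdf (gaussianReal 0 1) w

/-- The density of the standard Gaussian. -/
noncomputable def dens (w : ℝ) : ℝ := gaussianPDFReal 0 1 w

lemma dens_eq (w : ℝ) : dens w = (√(2 * Real.pi))⁻¹ * Real.exp (-w ^ 2 / 2) := by
  simp [dens, gaussianPDFReal]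

lemma dens_pos (w : ℝ) : 0 < dens w := gaussianPDFReal_pos 0 1 w one_ne_zero

lemma dens_neg (w : ℝ) : dens (-w) = dens w := by simp [dens_eq]

lemma hasDerivAt_dens (w : ℝ) : HasDerivAt dens (-w * dens w) w := by
  have h : HasDerivAt (fun w : ℝ => (√(2 * Real.pi))⁻¹ * Real.exp (-w ^ 2 / 2))
      ((√(2 * Real.pi))⁻¹ * (Real.exp (-w ^ 2 / 2) * (-(2 * w) / 2))) w := by
    have := ((((hasDerivAt_id w).pow 2).neg.div_const 2).exp).const_mul (√(2 * Real.pi))⁻¹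
    simpa using this
  have e : dens = fun w : ℝ => (√(2 * Real.pi))⁻¹ * Real.exp (-w ^ 2 / 2) := funext dens_eq
  rw [e]
  convert h using 1
  ring

lemma continuous_dens : Continuous dens :=
  continuous_iff_continuousAt.2 fun w => (hasDerivAt_dens w).continuousAt

lemma sqrt_two_pi_le : √(2 * Real.pi) ≤ 2.6 := by
  rw [Real.sqrt_le_left (by norm_num)]
  nlinarith [Real.pi_lt_d2]

lemma one_le_sqrt_two_pi : 1 ≤ √(2 * Real.pi) := by
  rw [Real.one_le_sqrt]
  nlinarith [Real.pi_gt_three]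

lemma dens_le_one (w : ℝ) : dens w ≤ 1 := by
  rw [dens_eq]
  have h1 : (√(2 * Real.pi))⁻¹ ≤ 1 := inv_le_one_of_one_le₀ one_le_sqrt_two_pi
  have h2 : Real.exp (-w ^ 2 / 2) ≤ 1 := Real.exp_le_one_iff.2 (by nlinarith [sq_nonneg w])
  exact mul_le_one₀ h1 (Real.exp_pos _).le h2

lemma one_le_six_mul_dens {w : ℝ} (h0 : 0 ≤ w) (h1 : w ≤ 1) : 1 ≤ 6 * dens w := by
  rw [dens_eq]
  have h2 : (1 / 2 : ℝ) ≤ Real.exp (-w ^ 2 / 2) := by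
    have := Real.add_one_le_exp (-w ^ 2 / 2)
    nlinarith
  have h3 : (1 / 2.6 : ℝ) ≤ (√(2 * Real.pi))⁻¹ := by
    rw [one_div]
    exact inv_anti₀ (by linarith [one_le_sqrt_two_pi]) sqrt_two_pi_le
  have := mul_le_mul h3 h2 (by norm_num) (by positivity)
  linarith

lemma Phi_nonneg (w : ℝ) : 0 ≤ Phi w := cdf_nonneg _ _

lemma Phi_le_one (w : ℝ) : Phi w ≤ 1 := cdf_le_one _ _

lemma monotone_Phi : Monotone Phi := monotone_cdf _

lemma Phi_neg (w : ℝ) : Phi (-w) = 1 - Phi w := by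
  have hna : NullSingletonClass (gaussianReal 0 1) := nullSingletonClass_gaussianReal one_ne_zero
  have h : (gaussianReal 0 1).map (fun x => -x) = gaussianReal 0 1 := by
    simpa using gaussianReal_map_neg (μ := 0) (v := 1)
  unfold Phi
  rw [cdf_eq_real, cdf_eq_real]
  conv_lhs => rw [← h]
  rw [map_measureReal_apply measurable_neg measurableSet_Iic]
  have h1 : (fun x : ℝ => -x) ⁻¹' Set.Iic (-w) = (Set.Iio w)ᶜ := by
    ext x; simp
  rw [h1, probReal_compl_eq_one_sub measurableSet_Iio]
  congr 1
  exact measureReal_congr Iio_ae_eq_Iic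

lemma Phi_sub (a b : ℝ) : Phi b - Phi a = ∫ x in a..b, dens x := by
  have key : ∀ c, Phi c = ∫ x in Set.Iic c, dens x := by
    intro c
    unfold Phi
    rw [cdf_eq_real, measureReal_def, gaussianReal_apply_eq_integral 0 one_ne_zero,
      ENNReal.toReal_ofReal]
    · rfl
    · exact integral_nonneg fun x => gaussianPDFReal_nonneg 0 1 x
  have hi : Integrable dens := integrable_gaussianPDFReal 0 1
  rw [key, key]
  exact intervalIntegral.integral_Iic_sub_Iic hi.integrableOn hi.integrableOn

lemma hasDerivAt_Phi (w : ℝ) : HasDerivAt Phi (dens w) w := by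
  have h : HasDerivAt (fun b => Phi 0 + ∫ x in (0 : ℝ)..b, dens x) (dens w) w := by
    refine (intervalIntegral.integral_hasDerivAt_right
      (continuous_dens.intervalIntegrable _ _)
      (continuous_dens.stronglyMeasurableAtFilter _ _)
      continuous_dens.continuousAt).const_add _
  refine h.congr_of_eventuallyEq (Eventually.of_forall fun b => ?_)
  have := Phi_sub 0 b
  simp only
  linarith

lemma Phi_le_add {a b : ℝ} (h : a ≤ b) : Phi b ≤ Phi a + (b - a) := by
  have := Convex.norm_image_sub_le_of_norm_hasDerivWithin_le (f := Phi) (f' := dens) (C := 1)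
    (s := Set.univ) (x := a) (y := b) (fun x _ => (hasDerivAt_Phi x).hasDerivWithinAt)
    (fun x _ => by rw [Real.norm_of_nonneg (dens_pos x).le]; exact dens_le_one x) convex_univ
    (Set.mem_univ _) (Set.mem_univ _)
  rw [Real.norm_eq_abs, Real.norm_eq_abs, abs_of_nonneg (sub_nonneg.2 h)] at this
  linarith [le_abs_self (Phi b - Phi a)]

/-- The Mills ratio bound `w (1 - Φ(w)) ≤ φ(w)`. -/
lemma mul_one_sub_Phi_le {w : ℝ} (hw : 0 < w) : w * (1 - Phi w) ≤ dens w := by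
  -- The difference φ(x)/x − (1 − Φ(x)) has derivative −φ(x)/x², so it decreases; it tends to 0 at
  -- infinity and is therefore nonnegative.
  have hd : ∀ x, 0 < x → HasDerivAt (fun x => dens x / x - (1 - Phi x)) (-(dens x / x ^ 2)) x := by
    intro x hx
    have h := ((hasDerivAt_dens x).div (hasDerivAt_id x) hx.ne').sub
      ((hasDerivAt_Phi x).const_sub 1)
    refine h.congr_deriv ?_
    simp only [id]
    field_simp
    ring
  have hanti : AntitoneOn (fun x => dens x / x - (1 - Phi x)) (Set.Ioi 0) := by
    refine antitoneOn_of_deriv_nonpos (convex_Ioi 0) ?_ ?_ ?_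
    · exact fun x hx => (hd x hx).continuousAt.continuousWithinAt
    · rw [interior_Ioi]
      exact fun x hx => (hd x hx).differentiableAt.differentiableWithinAt
    · rw [interior_Ioi]
      intro x hx
      rw [(hd x hx).deriv]
      have := dens_pos x
      simp only [Left.neg_nonpos_iff]
      positivity
  have hlim : Tendsto (fun x => dens x / x - (1 - Phi x)) atTop (𝓝 0) := by
    have h1 : Tendsto (fun x => dens x / x) atTop (𝓝 0) := by
      refine squeeze_zero' (g := fun x => x⁻¹) ?_ ?_ tendsto_inv_atTop_zero
      · filter_upwards [eventually_gt_atTop 0] with x hx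
        exact div_nonneg (dens_pos x).le hx.le
      · filter_upwards [eventually_gt_atTop 0] with x hx
        rw [div_eq_mul_inv]
        exact mul_le_of_le_one_left (inv_nonneg.2 hx.le) (dens_le_one x)
    have h2 : Tendsto Phi atTop (𝓝 1) := tendsto_cdf_atTop _
    simpa using h1.sub (h2.const_sub 1)
  have h0 : 0 ≤ dens w / w - (1 - Phi w) := by
    refine le_of_tendsto hlim ?_
    filter_upwards [eventually_ge_atTop w] with x hx
    exact hanti hw (hw.trans_le hx) hx
  have h1 : (1 - Phi w) ≤ dens w / w := by linarith
  rw [le_div_iff₀ hw] at h1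
  linarith

lemma one_sub_Phi_le {w : ℝ} (hw : 0 ≤ w) : 1 - Phi w ≤ 6 * dens w := by
  rcases le_total w 1 with h | h
  · linarith [one_le_six_mul_dens hw h, Phi_nonneg w]
  · have := mul_one_sub_Phi_le (by linarith : 0 < w)
    nlinarith [Phi_le_one w, dens_pos w]

lemma abs_mul_Phi_le {w : ℝ} (hw : w ≤ 0) : |w| * Phi w ≤ dens w := by
  rcases hw.eq_or_lt with rfl | hw
  · simp [(dens_pos 0).le]
  · have := mul_one_sub_Phi_le (neg_pos.2 hw)
    rw [Phi_neg, dens_neg] at this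
    rw [abs_of_neg hw]
    linarith

lemma Phi_le_six_mul_dens {w : ℝ} (hw : w ≤ 0) : Phi w ≤ 6 * dens w := by
  have := one_sub_Phi_le (neg_nonneg.2 hw)
  rw [Phi_neg, dens_neg] at this
  linarith

/-! ### The solution of Stein's equation for a half-line -/

/-- The branch of the Stein solution to the left of `z`. -/
noncomputable def left (z w : ℝ) : ℝ := Phi w * (1 - Phi z) / dens w

/-- The branch of the Stein solution to the right of `z`. -/
noncomputable def right (z w : ℝ) : ℝ := Phi z * (1 - Phi w) / dens w

/-- The bounded solution of `f'(w) - w f(w) = 1_{w ≤ z} - Φ(z)`. -/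
noncomputable def sol (z w : ℝ) : ℝ := if w ≤ z then left z w else right z w

/-- The derivative of the Stein solution. -/
noncomputable def solDeriv (z w : ℝ) : ℝ :=
  w * sol z w + ((Set.Iic z).indicator 1 w - Phi z)

lemma hasDerivAt_left (z w : ℝ) : HasDerivAt (left z) (w * left z w + (1 - Phi z)) w := by
  have h := ((hasDerivAt_Phi w).mul_const (1 - Phi z)).div (hasDerivAt_dens w) (dens_pos w).ne'
  refine h.congr_deriv ?_
  have := (dens_pos w).ne'
  unfold left
  field_simp
  ring

lemma hasDerivAt_right (z w : ℝ) : HasDerivAt (right z) (w * right z w - Phi z) w := by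
  have h := (((hasDerivAt_Phi w).const_sub 1).const_mul (Phi z)).div (hasDerivAt_dens w)
    (dens_pos w).ne'
  refine h.congr_deriv ?_
  have := (dens_pos w).ne'
  unfold right
  field_simp
  ring

lemma sol_of_le {z w : ℝ} (h : w ≤ z) : sol z w = left z w := if_pos h

lemma sol_of_ge {z w : ℝ} (h : z ≤ w) : sol z w = right z w := by
  rcases h.eq_or_lt with rfl | h
  · simp [sol, left, right]
  · exact if_neg (not_le.2 h)

lemma solDeriv_of_le {z w : ℝ} (h : w ≤ z) : solDeriv z w = w * left z w + (1 - Phi z) := by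
  simp [solDeriv, sol_of_le h, h]

lemma solDeriv_of_gt {z w : ℝ} (h : z < w) : solDeriv z w = w * right z w - Phi z := by
  simp [solDeriv, sol_of_ge h.le, h]
  ring

lemma sol_nonneg (z w : ℝ) : 0 ≤ sol z w := by
  have h1 := Phi_nonneg w
  have h2 := Phi_nonneg z
  have h3 := Phi_le_one w
  have h4 := Phi_le_one z
  have h5 := dens_pos w
  unfold sol left right
  split_ifs
  · exact div_nonneg (mul_nonneg h1 (by linarith)) h5.le
  · exact div_nonneg (mul_nonneg h2 (by linarith)) h5.le

/-- Both branches multiply to Φ(min(w,z)) (1 − Φ(max(w,z))), which monotonicity bounds by Φ(w) and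
by 1 − Φ(w). The first bound is useful for w ≤ 0, the second for w ≥ 0, where the Mills ratio
applies. -/
lemma sol_mul_dens_le_Phi (z w : ℝ) : sol z w * dens w ≤ Phi w := by
  have h1 := Phi_nonneg w
  have h2 := Phi_nonneg z
  have h3 := Phi_le_one w
  have h4 := Phi_le_one z
  unfold sol left right
  split_ifs with h
  · rw [div_mul_cancel₀ _ (dens_pos w).ne']
    nlinarith
  · rw [div_mul_cancel₀ _ (dens_pos w).ne']
    have := monotone_Phi (not_le.1 h).le
    nlinarith

lemma sol_mul_dens_le_one_sub_Phi (z w : ℝ) : sol z w * dens w ≤ 1 - Phi w := by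
  have h1 := Phi_nonneg w
  have h2 := Phi_nonneg z
  have h3 := Phi_le_one w
  have h4 := Phi_le_one z
  unfold sol left right
  split_ifs with h
  · rw [div_mul_cancel₀ _ (dens_pos w).ne']
    have := monotone_Phi h
    nlinarith
  · rw [div_mul_cancel₀ _ (dens_pos w).ne']
    nlinarith

lemma sol_le (z w : ℝ) : sol z w ≤ 6 := by
  have hd := dens_pos w
  rcases le_total w 0 with h | h
  · have h1 := (sol_mul_dens_le_Phi z w).trans (Phi_le_six_mul_dens h)
    exact le_of_mul_le_mul_right h1 hd
  · have h1 := (sol_mul_dens_le_one_sub_Phi z w).trans (one_sub_Phi_le h)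
    exact le_of_mul_le_mul_right h1 hd

lemma abs_mul_sol_le (z w : ℝ) : |w * sol z w| ≤ 1 := by
  have hd := dens_pos w
  have hs := sol_nonneg z w
  rw [abs_mul, abs_of_nonneg hs]
  refine le_of_mul_le_mul_right ?_ hd
  rw [mul_assoc, one_mul]
  rcases le_total w 0 with h | h
  · exact (mul_le_mul_of_nonneg_left (sol_mul_dens_le_Phi z w) (abs_nonneg w)).trans
      (abs_mul_Phi_le h)
  · rcases h.eq_or_lt with rfl | h
    · simp [hd.le]
    · rw [abs_of_pos h]
      exact (mul_le_mul_of_nonneg_left (sol_mul_dens_le_one_sub_Phi z w) h.le).trans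
        (mul_one_sub_Phi_le h)

lemma abs_solDeriv_le (z w : ℝ) : |solDeriv z w| ≤ 2 := by
  have h1 := abs_mul_sol_le z w
  have h2 : |(Set.Iic z).indicator (1 : ℝ → ℝ) w - Phi z| ≤ 1 := by
    have := Phi_nonneg z
    have := Phi_le_one z
    by_cases h : w ≤ z
    · simp only [Set.indicator, Set.mem_Iic, h, if_true, Pi.one_apply]
      rw [abs_le]; constructor <;> linarith
    · simp only [Set.indicator, Set.mem_Iic, h, if_false]
      rw [abs_le]; constructor <;> linarith
  unfold solDeriv
  exact (abs_add_le _ _).trans (by linarith)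

/-- On either side of `z`, the mean value theorem for the Stein solution. -/
lemma exists_sol_sub_eq (z : ℝ) {u v : ℝ} (huv : u < v) (h : v ≤ z ∨ z ≤ u) :
    ∃ c ∈ Set.Ioo u v, sol z v - sol z u = solDeriv z c * (v - u) := by
  rcases h with h | h
  · obtain ⟨c, hc, hc'⟩ := exists_hasDerivAt_eq_slope (left z) _ huv
      (fun x _ => (hasDerivAt_left z x).continuousAt.continuousWithinAt)
      (fun x _ => hasDerivAt_left z x)
    refine ⟨c, hc, ?_⟩
    rw [solDeriv_of_le (hc.2.le.trans h), hc', sol_of_le h, sol_of_le (huv.le.trans h),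
      div_mul_cancel₀ _ (sub_pos.2 huv).ne']
  · obtain ⟨c, hc, hc'⟩ := exists_hasDerivAt_eq_slope (right z) _ huv
      (fun x _ => (hasDerivAt_right z x).continuousAt.continuousWithinAt)
      (fun x _ => hasDerivAt_right z x)
    refine ⟨c, hc, ?_⟩
    rw [solDeriv_of_gt (h.trans_lt hc.1), hc', sol_of_ge h, sol_of_ge (h.trans huv.le),
      div_mul_cancel₀ _ (sub_pos.2 huv).ne']

lemma abs_sol_sub_le (z u v : ℝ) : |sol z v - sol z u| ≤ 2 * |v - u| := by
  have key : ∀ u v : ℝ, u < v → (v ≤ z ∨ z ≤ u) → |sol z v - sol z u| ≤ 2 * (v - u) := by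
    intro u v huv h
    obtain ⟨c, -, hc⟩ := exists_sol_sub_eq z huv h
    rw [hc, abs_mul, abs_of_pos (sub_pos.2 huv)]
    exact mul_le_mul_of_nonneg_right (abs_solDeriv_le z c) (sub_pos.2 huv).le
  have key2 : ∀ u v : ℝ, u < v → |sol z v - sol z u| ≤ 2 * (v - u) := by
    intro u v huv
    by_cases h : v ≤ z ∨ z ≤ u
    · exact key u v huv h
    · push Not at h
      have h1 := key u z h.2 (Or.inl le_rfl)
      have h2 := key z v h.1 (Or.inr le_rfl)
      have := abs_sub_le (sol z v) (sol z z) (sol z u)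
      linarith
  rcases lt_trichotomy u v with h | rfl | h
  · rw [abs_of_pos (sub_pos.2 h)]; exact key2 u v h
  · simp
  · rw [abs_sub_comm, abs_sub_comm v u, abs_of_pos (sub_pos.2 h)]; exact key2 v u h

lemma continuous_sol (z : ℝ) : Continuous (sol z) := by
  have : LipschitzWith 2 (sol z) := LipschitzWith.of_dist_le_mul fun x y => by
    simpa [Real.dist_eq] using abs_sol_sub_le z y x
  exact this.continuous

lemma measurable_solDeriv (z : ℝ) : Measurable (solDeriv z) := by
  unfold solDeriv
  exact (measurable_id.mul (continuous_sol z).measurable).add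
    ((measurable_one.indicator measurableSet_Iic).sub_const _)

/-- The modulus controlling increments of the derivative of the Stein solution. -/
noncomputable def modulus (z w x : ℝ) : ℝ :=
  (6 + 2 * |w|) * min 1 |x| + 4 * (Set.Icc (z - |x|) (z + |x|)).indicator 1 w

/-- Long increments use only |w f(w)| ≤ 1; short ones use the product rule with |f| ≤ 6 and
Lipschitz constant 2. -/
lemma abs_mul_sol_sub_le (z w u : ℝ) :
    |u * sol z u - w * sol z w| ≤ (6 + 2 * |w|) * min 1 |u - w| := by
  rcases le_total 1 |u - w| with h | h
  · rw [min_eq_left h]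
    have h1 := abs_mul_sol_le z u
    have h2 := abs_mul_sol_le z w
    have := abs_sub (u * sol z u) (w * sol z w)
    have := abs_nonneg w
    linarith
  · rw [min_eq_right h]
    have e : u * sol z u - w * sol z w = (u - w) * sol z u + w * (sol z u - sol z w) := by ring
    rw [e]
    have h1 : |(u - w) * sol z u| ≤ 6 * |u - w| := by
      rw [abs_mul, abs_of_nonneg (sol_nonneg z u), mul_comm]
      exact mul_le_mul_of_nonneg_right (sol_le z u) (abs_nonneg _)
    have h2 : |w * (sol z u - sol z w)| ≤ |w| * (2 * |u - w|) := by
      rw [abs_mul]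
      exact mul_le_mul_of_nonneg_left (abs_sol_sub_le z w u) (abs_nonneg _)
    have := abs_add_le ((u - w) * sol z u) (w * (sol z u - sol z w))
    nlinarith

/-- If w is farther than |x| from z, then u and w lie on the same side of the jump, the indicators
cancel and only w f(w) varies. Otherwise the crude bound 2 + 2 applies. The point u is arbitrary so
that it can be the intermediate point of a mean value theorem. -/
lemma abs_solDeriv_sub_le_of_abs_le (z w x u : ℝ) (hu : |u - w| ≤ |x|) :
    |solDeriv z u - solDeriv z w| ≤ modulus z w x := by
  unfold modulus
  have hm : 0 ≤ (6 + 2 * |w|) * min 1 |x| :=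
    mul_nonneg (by positivity) (le_min zero_le_one (abs_nonneg _))
  by_cases h : w ∈ Set.Icc (z - |x|) (z + |x|)
  · rw [Set.indicator_of_mem h]
    have h1 := abs_solDeriv_le z u
    have h2 := abs_solDeriv_le z w
    have := abs_sub (solDeriv z u) (solDeriv z w)
    simp only [Pi.one_apply]
    linarith
  · rw [Set.indicator_of_notMem h]
    have hind : (Set.Iic z).indicator (1 : ℝ → ℝ) u = (Set.Iic z).indicator 1 w := by
      rw [Set.mem_Icc, not_and_or, not_le, not_le] at h
      rw [abs_le] at hu
      rcases h with h | h
      · have h1 : u ∈ Set.Iic z := by simp only [Set.mem_Iic]; linarith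
        have h2 : w ∈ Set.Iic z := by
          simp only [Set.mem_Iic]; linarith [abs_nonneg x]
        rw [Set.indicator_of_mem h1, Set.indicator_of_mem h2]; rfl
      · have h1 : u ∉ Set.Iic z := by simp only [Set.mem_Iic, not_le]; linarith
        have h2 : w ∉ Set.Iic z := by
          simp only [Set.mem_Iic, not_le]; linarith [abs_nonneg x]
        rw [Set.indicator_of_notMem h1, Set.indicator_of_notMem h2]
    have e : solDeriv z u - solDeriv z w = u * sol z u - w * sol z w := by
      unfold solDeriv; rw [hind]; ring
    rw [e, mul_zero, add_zero]
    exact (abs_mul_sol_sub_le z w u).trans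
      (mul_le_mul_of_nonneg_left (min_le_min_left _ hu) (by positivity))

lemma abs_solDeriv_sub_le (z w x : ℝ) :
    |solDeriv z (w + x) - solDeriv z w| ≤ modulus z w x :=
  abs_solDeriv_sub_le_of_abs_le z w x _ (by simp)

/-- Near z the Lipschitz bound and the bound on the derivative cost 4|x|, which the indicator term
of the modulus pays for. Away from z the segment does not cross the jump, and the mean value theorem
reduces to increments of the derivative. -/
lemma abs_sol_taylor_le (z w x : ℝ) :
    |sol z (w + x) - sol z w - x * solDeriv z w| ≤ |x| * modulus z w x := by
  by_cases h : w ∈ Set.Icc (z - |x|) (z + |x|)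
  · have h1 := abs_sol_sub_le z w (w + x)
    have h2 : |x * solDeriv z w| ≤ |x| * 2 := by
      rw [abs_mul]
      exact mul_le_mul_of_nonneg_left (abs_solDeriv_le z w) (abs_nonneg _)
    have h3 : 4 ≤ modulus z w x := by
      unfold modulus
      rw [Set.indicator_of_mem h]
      have : 0 ≤ (6 + 2 * |w|) * min 1 |x| :=
        mul_nonneg (by positivity) (le_min zero_le_one (abs_nonneg _))
      simp only [Pi.one_apply]
      linarith
    have h4 := mul_le_mul_of_nonneg_left h3 (abs_nonneg x)
    have := abs_sub (sol z (w + x) - sol z w) (x * solDeriv z w)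
    rw [add_sub_cancel_left] at h1
    linarith
  · rw [Set.mem_Icc, not_and_or, not_le, not_le] at h
    have hx := neg_abs_le x
    have hx' := le_abs_self x
    have hx0 := abs_nonneg x
    obtain ⟨c, hc, hc'⟩ : ∃ c, |c - w| ≤ |x| ∧ sol z (w + x) - sol z w = solDeriv z c * x := by
      rcases lt_trichotomy x 0 with h0 | rfl | h0
      · obtain ⟨c, hc, hc'⟩ := exists_sol_sub_eq z (u := w + x) (v := w) (by linarith)
          (by rcases h with h | h <;> [left; right] <;> linarith)
        refine ⟨c, ?_, by linear_combination -hc'⟩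
        rw [abs_of_neg h0, abs_le]; constructor <;> linarith [hc.1, hc.2]
      · exact ⟨w, by simp⟩
      · obtain ⟨c, hc, hc'⟩ := exists_sol_sub_eq z (u := w) (v := w + x) (by linarith)
          (by rcases h with h | h <;> [left; right] <;> linarith)
        refine ⟨c, ?_, by linear_combination hc'⟩
        rw [abs_of_pos h0, abs_le]; constructor <;> linarith [hc.1, hc.2]
    rw [hc']
    have e : solDeriv z c * x - x * solDeriv z w = x * (solDeriv z c - solDeriv z w) := by ring
    rw [e, abs_mul]
    exact mul_le_mul_of_nonneg_left (abs_solDeriv_sub_le_of_abs_le z w x c hc) hx0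

lemma measurable_modulus (z : ℝ) : Measurable (fun q : ℝ × ℝ => modulus z q.1 q.2) := by
  unfold modulus
  have h : MeasurableSet {q : ℝ × ℝ | q.1 ∈ Set.Icc (z - |q.2|) (z + |q.2|)} := by
    have h1 : MeasurableSet {q : ℝ × ℝ | z - |q.2| ≤ q.1} :=
      measurableSet_le (by fun_prop) (by fun_prop)
    have h2 : MeasurableSet {q : ℝ × ℝ | q.1 ≤ z + |q.2|} :=
      measurableSet_le (by fun_prop) (by fun_prop)
    exact h1.inter h2
  have e : (fun q : ℝ × ℝ => (Set.Icc (z - |q.2|) (z + |q.2|)).indicator (1 : ℝ → ℝ) q.1)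
      = {q : ℝ × ℝ | q.1 ∈ Set.Icc (z - |q.2|) (z + |q.2|)}.indicator 1 := by
    ext q; simp [Set.indicator]
  refine Measurable.add (by fun_prop) (Measurable.const_mul ?_ 4)
  rw [e]
  exact measurable_one.indicator h

end SteinGaussian

namespace BerryEsseen

variable {Ω : Type*} [MeasurableSpace Ω] {P : Measure Ω}

/-! ### Preliminaries on independent sums -/

/-- Fubini for the product law: V is integrated first, at a fixed value x of X, so that
concentration bounds for V alone can be used inside joint expectations. -/
lemma integral_le_of_indepFun [IsProbabilityMeasure P] {V X : Ω → ℝ} (hVX : IndepFun V X P) (hV : Measurable V)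
    (hX : Measurable X) {e : ℝ × ℝ → ℝ} (he : Measurable e)
    (hint : Integrable (fun ω => e (V ω, X ω)) P) {h : ℝ → ℝ} (hh : Measurable h)
    (hhint : Integrable (fun ω => h (X ω)) P) (hle : ∀ x, ∫ ω, e (V ω, x) ∂P ≤ h x) :
    ∫ ω, e (V ω, X ω) ∂P ≤ ∫ ω, h (X ω) ∂P := by
  have hmap : P.map (fun ω => (V ω, X ω)) = (P.map V).prod (P.map X) :=
    (indepFun_iff_map_prod_eq_prod_map_map hV.aemeasurable hX.aemeasurable).1 hVX
  have hVXm : Measurable fun ω => (V ω, X ω) := hV.prodMk hX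
  have h1 : ∫ ω, e (V ω, X ω) ∂P = ∫ q, e q ∂(P.map (fun ω => (V ω, X ω))) :=
    (integral_map hVXm.aemeasurable he.aestronglyMeasurable).symm
  have hp1 : IsProbabilityMeasure (P.map V) := Measure.isProbabilityMeasure_map hV.aemeasurable
  have hp2 : IsProbabilityMeasure (P.map X) := Measure.isProbabilityMeasure_map hX.aemeasurable
  have hi : Integrable e ((P.map V).prod (P.map X)) := by
    rw [← hmap]
    exact (integrable_map_measure he.aestronglyMeasurable hVXm.aemeasurable).2 hint
  rw [h1, hmap, integral_prod_symm _ hi,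
    ← integral_map (f := h) hX.aemeasurable hh.aestronglyMeasurable]
  refine integral_mono hi.integral_prod_right
    ((integrable_map_measure hh.aestronglyMeasurable hX.aemeasurable).2 hhint) fun x => ?_
  have : ∫ w, e (w, x) ∂(P.map V) = ∫ ω, e (V ω, x) ∂P :=
    integral_map hV.aemeasurable (he.comp (measurable_id.prodMk measurable_const)).aestronglyMeasurable
  exact this.trans_le (hle x)

lemma integral_abs_le_one [IsProbabilityMeasure P] {V : Ω → ℝ} (hV : MemLp V 2 P) (h : ∫ ω, V ω ^ 2 ∂P ≤ 1) :
    ∫ ω, |V ω| ∂P ≤ 1 := by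
  have h1 : ∫ ω, |V ω| ∂P ≤ ∫ ω, (1 / 2 + V ω ^ 2 / 2) ∂P := by
    refine integral_mono (hV.integrable one_le_two).abs
      ((integrable_const _).add (hV.integrable_sq.div_const 2)) fun ω => ?_
    have := sq_nonneg (|V ω| - 1)
    rw [sub_sq, sq_abs] at this
    simp only
    linarith
  rw [integral_add (integrable_const _) (hV.integrable_sq.div_const 2),
    integral_div 2 fun ω => V ω ^ 2] at h1
  simp only [integral_const, probReal_univ, one_smul] at h1
  linarith

variable {ι : Type*} {X : ι → Ω → ℝ} {T : Finset ι}

lemma variance_sum_eq (hi : iIndepFun X P) (h2 : ∀ i ∈ T, MemLp (X i) 2 P) :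
    Var[fun ω => ∑ i ∈ T, X i ω; P] = ∑ i ∈ T, Var[X i; P] := by
  rw [← IndepFun.variance_sum h2 fun i _ j _ hij => hi.indepFun hij]
  congr 1
  ext ω
  simp

lemma memLp_sum (h2 : ∀ i ∈ T, MemLp (X i) 2 P) : MemLp (fun ω => ∑ i ∈ T, X i ω) 2 P :=
  memLp_finsetSum _ h2

lemma integral_sq_sum [IsProbabilityMeasure P] (hi : iIndepFun X P) (h2 : ∀ i ∈ T, MemLp (X i) 2 P)
    (h0 : ∀ i ∈ T, ∫ ω, X i ω ∂P = 0) :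
    ∫ ω, (∑ i ∈ T, X i ω) ^ 2 ∂P = ∑ i ∈ T, ∫ ω, X i ω ^ 2 ∂P := by
  have hz : ∫ ω, ∑ i ∈ T, X i ω ∂P = 0 := by
    rw [integral_finsetSum _ fun i hi => (h2 i hi).integrable one_le_two]
    exact Finset.sum_eq_zero h0
  rw [← variance_of_integral_eq_zero (memLp_sum h2).aemeasurable hz, variance_sum_eq hi h2]
  exact Finset.sum_congr rfl fun i hi' =>
    variance_of_integral_eq_zero (h2 i hi').aemeasurable (h0 i hi')

lemma indepFun_sum_erase [DecidableEq ι] (hm : ∀ i, Measurable (X i)) (hi : iIndepFun X P)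
    (i : ι) : IndepFun (fun ω => ∑ j ∈ T.erase i, X j ω) (X i) P := by
  have := hi.indepFun_finsetSum_of_notMem hm (Finset.notMem_erase i T)
  convert this using 1
  ext ω
  simp

/-! ### The concentration inequality -/

/-- The truncation of `v` to `[a - δ, b + δ]`, centred at the midpoint. -/
noncomputable def clamp (a b δ v : ℝ) : ℝ := max (a - δ) (min (b + δ) v) - (a + b) / 2

lemma measurable_clamp (a b δ : ℝ) : Measurable (clamp a b δ) := by
  unfold clamp; fun_prop

lemma abs_clamp_le {a b δ : ℝ} (hab : a ≤ b) (hδ : 0 ≤ δ) (v : ℝ) :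
    |clamp a b δ v| ≤ (b - a) / 2 + δ := by
  unfold clamp
  have h1 : max (a - δ) (min (b + δ) v) ≤ b + δ := max_le (by linarith) (min_le_left _ _)
  have h2 := le_max_left (a - δ) (min (b + δ) v)
  rw [abs_le]; constructor <;> linarith

lemma monotone_clamp (a b δ : ℝ) : Monotone (clamp a b δ) := fun u v h => by
  unfold clamp
  have := max_le_max_left (a - δ) (min_le_min_left (b + δ) h)
  linarith

/-- The clamp has slope one on [a − δ, b + δ]. From a point of [a, b], a shift by x thus moves it by
at least min(δ, |x|) in the direction of the shift; from other points monotonicity gives the sign.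
-/
lemma indicator_mul_le_clamp {a b δ : ℝ} (hδ : 0 ≤ δ) (v x : ℝ) :
    (Set.Icc a b).indicator 1 v * (|x| * min δ |x|) ≤
      x * (clamp a b δ v - clamp a b δ (v - x)) := by
  by_cases hv : v ∈ Set.Icc a b
  · rw [Set.indicator_of_mem hv, Pi.one_apply, one_mul]
    have e1 : clamp a b δ v = v - (a + b) / 2 := by
      unfold clamp
      rw [min_eq_right (by linarith [hv.2]), max_eq_right (by linarith [hv.1])]
    rcases le_total 0 x with hx | hx
    · rw [abs_of_nonneg hx]
      refine mul_le_mul_of_nonneg_left ?_ hx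
      have h1 := monotone_clamp a b δ (show v - x ≤ v - min δ x by
        linarith [min_le_right δ x])
      have e2 : clamp a b δ (v - min δ x) = v - min δ x - (a + b) / 2 := by
        unfold clamp
        rw [min_eq_right (by linarith [hv.2, le_min hδ hx]),
          max_eq_right (by linarith [hv.1, min_le_left δ x])]
      linarith
    · rw [abs_of_nonpos hx]
      have h1 := monotone_clamp a b δ (show v + min δ (-x) ≤ v - x by
        linarith [min_le_right δ (-x)])
      have e2 : clamp a b δ (v + min δ (-x)) = v + min δ (-x) - (a + b) / 2 := by
        unfold clamp
        rw [min_eq_right (by linarith [hv.2, min_le_left δ (-x)]),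
          max_eq_right (by linarith [hv.1, le_min hδ (neg_nonneg.2 hx)])]
      have h3 : min δ (-x) ≤ clamp a b δ (v - x) - clamp a b δ v := by linarith
      have := mul_le_mul_of_nonneg_left h3 (neg_nonneg.2 hx)
      linarith
  · rw [Set.indicator_of_notMem hv, zero_mul]
    rcases le_total 0 x with hx | hx
    · exact mul_nonneg hx (sub_nonneg.2 (monotone_clamp a b δ (by linarith)))
    · exact mul_nonneg_of_nonpos_of_nonpos hx
        (sub_nonpos.2 (monotone_clamp a b δ (by linarith)))

lemma integral_abs_sub_le [IsProbabilityMeasure P] {H : Ω → ℝ} (hH : MemLp H 2 P) {δ : ℝ} (hδ : 0 < δ)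
    (hvar : Var[H; P] ≤ δ ^ 2) : ∫ ω, |H ω - ∫ ω, H ω ∂P| ∂P ≤ δ := by
  set m := ∫ ω, H ω ∂P
  have hD : MemLp (fun ω => H ω - m) 2 P := hH.sub (memLp_const m)
  have h1 : ∫ ω, |H ω - m| ∂P ≤ ∫ ω, (δ / 2 + (H ω - m) ^ 2 / (2 * δ)) ∂P := by
    refine integral_mono (hD.integrable one_le_two).abs
      ((integrable_const _).add (hD.integrable_sq.div_const _)) fun ω => ?_
    have h := sq_nonneg (|H ω - m| - δ)
    rw [sub_sq, sq_abs] at h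
    have e : δ / 2 + (H ω - m) ^ 2 / (2 * δ) = (δ ^ 2 + (H ω - m) ^ 2) / (2 * δ) := by
      field_simp
    simp only
    rw [e, le_div_iff₀ (by positivity)]
    linarith
  rw [integral_add (integrable_const _) (hD.integrable_sq.div_const _),
    integral_div (2 * δ) fun ω => (H ω - m) ^ 2, ← variance_eq_integral hH.aemeasurable] at h1
  simp only [integral_const, probReal_univ, one_smul] at h1
  have h2 : Var[H; P] / (2 * δ) ≤ δ ^ 2 / (2 * δ) := by gcongr
  have h3 : δ ^ 2 / (2 * δ) = δ / 2 := by field_simp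
  linarith

/-- The clamp c of [a, b] is tested against V. Since E|V| ≤ 1, E[V c(V)] is at most (b − a)/2 + δ.
From below, E[X_i c(V − X_i)] = 0 by independence, so E[V c(V)] dominates E[1_A S] with S = ∑ |X_i|
min(δ, |X_i|). As Var S ≤ δ², replacing S by its mean costs only another δ. -/
theorem concentration [IsProbabilityMeasure P] (hm : ∀ i, Measurable (X i)) (hi : iIndepFun X P)
    (h2 : ∀ i ∈ T, MemLp (X i) 2 P) (h0 : ∀ i ∈ T, ∫ ω, X i ω ∂P = 0)
    (hv : ∑ i ∈ T, ∫ ω, X i ω ^ 2 ∂P ≤ 1) {a b δ : ℝ} (hab : a ≤ b) (hδ : 0 < δ) :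
    P.real {ω | ∑ i ∈ T, X i ω ∈ Set.Icc a b} * ∑ i ∈ T, ∫ ω, |X i ω| * min δ |X i ω| ∂P
      ≤ (b - a) / 2 + 2 * δ := by
  classical
  set V : Ω → ℝ := fun ω => ∑ i ∈ T, X i ω with hVdef
  set c := clamp a b δ with hc
  set H : ι → Ω → ℝ := fun i ω => |X i ω| * min δ |X i ω| with hH
  set A : Set Ω := {ω | V ω ∈ Set.Icc a b} with hA
  have hVm : Measurable V := Finset.measurable_sum _ fun i _ => hm i
  have hAm : MeasurableSet A := hVm measurableSet_Icc
  have hcb := abs_clamp_le hab hδ.le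
  have hcm := measurable_clamp a b δ
  have hint : ∀ i ∈ T, ∀ {Y : Ω → ℝ}, Measurable Y → Integrable (fun ω => X i ω * c (Y ω)) P := by
    intro i hiT Y hY
    exact ((h2 i hiT).integrable one_le_two).mul_bdd (c := (b - a) / 2 + δ)
      (hcm.comp hY).aestronglyMeasurable (Eventually.of_forall fun ω => hcb _)
  have hHm : ∀ i, Measurable (H i) := fun i => by
    have := hm i
    simp only [hH]; fun_prop
  have hHb : ∀ i ω, |H i ω| ≤ δ * |X i ω| := fun i ω => by
    have h1 : 0 ≤ min δ |X i ω| := le_min hδ.le (abs_nonneg _)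
    simp only [hH]
    rw [abs_mul, abs_abs, abs_of_nonneg h1, mul_comm]
    exact mul_le_mul_of_nonneg_right (min_le_left _ _) (abs_nonneg _)
  have hH2 : ∀ i ∈ T, MemLp (H i) 2 P := fun i hiT =>
    ((h2 i hiT).const_mul δ).mono (hHm i).aestronglyMeasurable (Eventually.of_forall fun ω => by
      rw [Real.norm_eq_abs, Real.norm_eq_abs, abs_mul δ, abs_of_pos hδ]; exact hHb i ω)
  have hHi : ∀ i ∈ T, Integrable (H i) P := fun i hiT => (hH2 i hiT).integrable one_le_two
  have hHindep : iIndepFun H P :=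
    hi.comp (fun _ x => |x| * min δ |x|) fun _ => by fun_prop
  -- the upper bound for `E[V c(V)]`
  have hV2 : MemLp V 2 P := memLp_sum h2
  have hVabs : ∫ ω, |V ω| ∂P ≤ 1 :=
    integral_abs_le_one hV2 ((integral_sq_sum hi h2 h0).trans_le hv)
  have hup : ∫ ω, V ω * c (V ω) ∂P ≤ (b - a) / 2 + δ := by
    have h1 : ∫ ω, V ω * c (V ω) ∂P ≤ ∫ ω, |V ω| * ((b - a) / 2 + δ) ∂P := by
      refine integral_mono ((hV2.integrable one_le_two).mul_bdd (c := (b - a) / 2 + δ)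
        (hcm.comp hVm).aestronglyMeasurable (Eventually.of_forall fun ω => hcb _))
        ((hV2.integrable one_le_two).abs.mul_const _) fun ω => ?_
      refine (le_abs_self _).trans ?_
      rw [abs_mul]
      exact mul_le_mul_of_nonneg_left (hcb _) (abs_nonneg _)
    rw [integral_mul_const] at h1
    have h3 : 0 ≤ (b - a) / 2 + δ := by linarith
    exact h1.trans (mul_le_of_le_one_left h3 hVabs)
  -- the lower bound
  have hterm : ∀ i ∈ T, ∫ ω, A.indicator 1 ω * H i ω ∂P ≤ ∫ ω, X i ω * c (V ω) ∂P := by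
    intro i hiT
    set Y : Ω → ℝ := fun ω => ∑ j ∈ T.erase i, X j ω with hY
    have hYm : Measurable Y := Finset.measurable_sum _ fun i _ => hm i
    have hVY : ∀ ω, V ω - X i ω = Y ω := fun ω => by
      simp only [hVdef, hY]
      rw [← Finset.sum_erase_add _ _ hiT]; ring
    have hz : ∫ ω, X i ω * c (Y ω) ∂P = 0 := by
      have hind : IndepFun (X i) Y P := (indepFun_sum_erase hm hi i).symm
      have := hind.integral_fun_comp_mul_comp (f := id) (g := c) (hm i).aemeasurable
        hYm.aemeasurable aestronglyMeasurable_id hcm.aestronglyMeasurable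
      simp only [id] at this
      rw [this, h0 i hiT, zero_mul]
    have hint1 : Integrable (fun ω => A.indicator 1 ω * H i ω) P := by
      have : (fun ω => A.indicator 1 ω * H i ω) = A.indicator (H i) := by
        ext ω; by_cases h : ω ∈ A <;> simp [h]
      rw [this]; exact (hHi i hiT).indicator hAm
    calc ∫ ω, A.indicator 1 ω * H i ω ∂P
        ≤ ∫ ω, (X i ω * c (V ω) - X i ω * c (Y ω)) ∂P := by
          refine integral_mono hint1 ((hint i hiT hVm).sub (hint i hiT hYm)) fun ω => ?_
          have := indicator_mul_le_clamp (a := a) (b := b) hδ.le (V ω) (X i ω)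
          rw [hVY, mul_sub] at this
          refine le_trans (le_of_eq ?_) this
          rfl
      _ = ∫ ω, X i ω * c (V ω) ∂P := by
          rw [integral_sub (hint i hiT hVm) (hint i hiT hYm), hz, sub_zero]
  set S : Ω → ℝ := fun ω => ∑ i ∈ T, H i ω with hS
  have hS2 : MemLp S 2 P := memLp_sum hH2
  have hSi : Integrable S P := hS2.integrable one_le_two
  have hSE : ∫ ω, S ω ∂P = ∑ i ∈ T, ∫ ω, H i ω ∂P := integral_finsetSum _ hHi
  have hVar : Var[S; P] ≤ δ ^ 2 := by
    rw [hS, variance_sum_eq hHindep hH2]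
    calc ∑ i ∈ T, Var[H i; P] ≤ ∑ i ∈ T, δ ^ 2 * ∫ ω, X i ω ^ 2 ∂P := by
          refine Finset.sum_le_sum fun i hiT => ?_
          refine (variance_le_expectation_sq (hHm i).aestronglyMeasurable).trans ?_
          rw [← integral_const_mul]
          refine integral_mono (hH2 i hiT).integrable_sq
            ((h2 i hiT).integrable_sq.const_mul _) fun ω => ?_
          have := pow_le_pow_left₀ (abs_nonneg _) (hHb i ω) 2
          rw [mul_pow, sq_abs, sq_abs] at this
          exact this
      _ = δ ^ 2 * ∑ i ∈ T, ∫ ω, X i ω ^ 2 ∂P := by rw [Finset.mul_sum]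
      _ ≤ δ ^ 2 := mul_le_of_le_one_right (by positivity) hv
  have hdev := integral_abs_sub_le hS2 hδ hVar
  set m := ∫ ω, S ω ∂P with hmdef
  have hlow : P.real A * m - δ ≤ ∫ ω, V ω * c (V ω) ∂P := by
    have e1 : ∫ ω, V ω * c (V ω) ∂P = ∑ i ∈ T, ∫ ω, X i ω * c (V ω) ∂P := by
      rw [← integral_finsetSum _ fun i hiT => hint i hiT hVm]
      refine integral_congr_ae (Eventually.of_forall fun ω => ?_)
      simp only [← Finset.sum_mul]; rfl
    have hIi : ∀ {Z : Ω → ℝ}, Integrable Z P → Integrable (fun ω => A.indicator 1 ω * Z ω) P := by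
      intro Z hZ
      have : (fun ω => A.indicator 1 ω * Z ω) = A.indicator Z := by
        ext ω; by_cases h : ω ∈ A <;> simp [h]
      rw [this]; exact hZ.indicator hAm
    have e2 : ∑ i ∈ T, ∫ ω, A.indicator 1 ω * H i ω ∂P = ∫ ω, A.indicator 1 ω * S ω ∂P := by
      rw [← integral_finsetSum _ fun i hiT => hIi (hHi i hiT)]
      refine integral_congr_ae (Eventually.of_forall fun ω => ?_)
      simp only [hS, Finset.mul_sum]
    have e3 : P.real A * m - ∫ ω, |S ω - m| ∂P ≤ ∫ ω, A.indicator 1 ω * S ω ∂P := by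
      have hAi : Integrable (fun ω => A.indicator (1 : Ω → ℝ) ω * m) P :=
        hIi (integrable_const m)
      have hAe : ∫ ω, A.indicator (1 : Ω → ℝ) ω * m ∂P = P.real A * m := by
        rw [integral_mul_const, integral_indicator_one hAm]
      have hDi : Integrable (fun ω => |S ω - m|) P := (hSi.sub (integrable_const m)).abs
      rw [← hAe, ← integral_sub hAi hDi]
      refine integral_mono (hAi.sub hDi) (hIi hSi) fun ω => ?_
      by_cases h : ω ∈ A
      · simp only [Set.indicator_of_mem h, Pi.one_apply, one_mul]
        linarith [neg_abs_le (S ω - m)]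
      · simp only [Set.indicator_of_notMem h, zero_mul]
        linarith [abs_nonneg (S ω - m)]
    rw [e1]
    have := Finset.sum_le_sum hterm
    linarith
  rw [← hSE]
  linarith

/-! ### One step of Stein's method -/

open SteinGaussian

lemma abs_indicator_one_le (s : Set ℝ) (w : ℝ) : |s.indicator (1 : ℝ → ℝ) w| ≤ 1 := by
  by_cases h : w ∈ s <;> simp [h]

lemma modulus_nonneg (z w x : ℝ) : 0 ≤ modulus z w x := by
  unfold modulus
  have h1 : 0 ≤ min 1 |x| := le_min zero_le_one (abs_nonneg x)
  have h2 : 0 ≤ (Set.Icc (z - |x|) (z + |x|)).indicator (1 : ℝ → ℝ) w :=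
    Set.indicator_nonneg (fun _ _ => zero_le_one) _
  positivity

lemma modulus_le (z w x : ℝ) : modulus z w x ≤ 10 + 2 * |w| := by
  unfold modulus
  have h1 : (6 + 2 * |w|) * min 1 |x| ≤ 6 + 2 * |w| :=
    mul_le_of_le_one_right (by positivity) (min_le_left _ _)
  have h2 := (le_abs_self _).trans (abs_indicator_one_le (Set.Icc (z - |x|) (z + |x|)) w)
  linarith

variable [IsProbabilityMeasure P] {V Y : Ω → ℝ} {z D : ℝ}

/-- The factor 16 is 8 + 8: one part from 6 + 2E|V| ≤ 8, the other from four times the probability 2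
min(1,|x|) + D. The cutoff at 1 is free because a probability never exceeds 1. -/
lemma integral_modulus_le (hV : Measurable V) (hV2 : MemLp V 2 P) (hV1 : ∫ ω, V ω ^ 2 ∂P ≤ 1)
    (hD : 0 ≤ D)
    (hconc : ∀ r, 0 ≤ r → P.real {ω | V ω ∈ Set.Icc (z - r) (z + r)} ≤ 2 * r + D) (x : ℝ) :
    ∫ ω, modulus z (V ω) x ∂P ≤ 16 * min 1 |x| + 4 * D := by
  have hVi : Integrable (fun ω => |V ω|) P := (hV2.integrable one_le_two).abs
  have hAm : MeasurableSet {ω | V ω ∈ Set.Icc (z - |x|) (z + |x|)} := hV measurableSet_Icc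
  have e : (fun ω => modulus z (V ω) x) = fun ω => (6 + 2 * |V ω|) * min 1 |x|
      + 4 * {ω | V ω ∈ Set.Icc (z - |x|) (z + |x|)}.indicator 1 ω := by
    ext ω; simp [modulus, Set.indicator]
  rw [e, integral_add, integral_mul_const, integral_const_mul, integral_indicator_one hAm,
    integral_add (integrable_const _) (hVi.const_mul 2), integral_const_mul]
  · simp only [integral_const, probReal_univ, one_smul]
    have h1 := integral_abs_le_one hV2 hV1
    have hm : 0 ≤ min 1 |x| := le_min zero_le_one (abs_nonneg x)
    have h2 : P.real {ω | V ω ∈ Set.Icc (z - |x|) (z + |x|)} ≤ 2 * min 1 |x| + D := by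
      rcases le_total 1 |x| with h | h
      · rw [min_eq_left h]
        have : P.real {ω | V ω ∈ Set.Icc (z - |x|) (z + |x|)} ≤ 1 := measureReal_le_one
        linarith
      · rw [min_eq_right h]
        exact hconc _ (abs_nonneg x)
    have h3 : (6 + 2 * ∫ ω, |V ω| ∂P) * min 1 |x| ≤ 8 * min 1 |x| :=
      mul_le_mul_of_nonneg_right (by linarith) hm
    linarith
  · exact ((integrable_const _).add (hVi.const_mul 2)).mul_const _
  · exact ((integrable_const (1 : ℝ)).indicator hAm).const_mul 4

lemma abs_integral_solDeriv_sub_le (hVY : IndepFun V Y P) (hV : Measurable V) (hY : Measurable Y)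
    (hV2 : MemLp V 2 P) (hV1 : ∫ ω, V ω ^ 2 ∂P ≤ 1) (hD : 0 ≤ D)
    (hconc : ∀ r, 0 ≤ r → P.real {ω | V ω ∈ Set.Icc (z - r) (z + r)} ≤ 2 * r + D) :
    |∫ ω, solDeriv z (V ω + Y ω) ∂P - ∫ ω, solDeriv z (V ω) ∂P|
      ≤ 16 * ∫ ω, min 1 |Y ω| ∂P + 4 * D := by
  have hgm := measurable_solDeriv z
  have hW : Measurable fun ω => V ω + Y ω := hV.add hY
  have hgi : ∀ {U : Ω → ℝ}, Measurable U → Integrable (fun ω => solDeriv z (U ω)) P := fun hU =>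
    Integrable.of_bound (hgm.comp hU).aestronglyMeasurable 2
      (Eventually.of_forall fun ω => abs_solDeriv_le z _)
  have hmi : Integrable (fun ω => min 1 |Y ω|) P :=
    Integrable.of_bound (by fun_prop) 1 (Eventually.of_forall fun ω => by
      rw [Real.norm_of_nonneg (le_min zero_le_one (abs_nonneg _))]; exact min_le_left _ _)
  have hMi : Integrable (fun ω => modulus z (V ω) (Y ω)) P := by
    refine Integrable.mono' (g := fun ω => 10 + 2 * |V ω|)
      ((integrable_const _).add ((hV2.integrable one_le_two).abs.const_mul 2))
      ((measurable_modulus z).comp (hV.prodMk hY)).aestronglyMeasurable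
      (Eventually.of_forall fun ω => ?_)
    rw [Real.norm_of_nonneg (modulus_nonneg _ _ _)]
    exact modulus_le _ _ _
  rw [← integral_sub (hgi hW) (hgi hV)]
  refine (abs_integral_le_integral_abs).trans ?_
  refine (integral_mono ((hgi hW).sub (hgi hV)).abs hMi
    fun ω => abs_solDeriv_sub_le z (V ω) (Y ω)).trans ?_
  refine (integral_le_of_indepFun hVY hV hY (e := fun q => modulus z q.1 q.2)
    (h := fun x => 16 * min 1 |x| + 4 * D) (measurable_modulus z) hMi (by fun_prop)
    ((hmi.const_mul 16).add (integrable_const _))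
    fun x => integral_modulus_le hV hV2 hV1 hD hconc x).trans (le_of_eq ?_)
  rw [integral_add (hmi.const_mul 16) (integrable_const _), integral_const_mul]
  simp

/-- Expand the Stein solution at V, which is independent of Y: the zeroth-order term vanishes
because Y is centred, the first-order term factorizes, and the remainder is averaged over V first.
-/
lemma abs_integral_mul_sol_sub_le (hVY : IndepFun V Y P) (hV : Measurable V) (hY : Measurable Y)
    (hV2 : MemLp V 2 P) (hV1 : ∫ ω, V ω ^ 2 ∂P ≤ 1) (hY2 : MemLp Y 2 P) (hY0 : ∫ ω, Y ω ∂P = 0)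
    (hD : 0 ≤ D)
    (hconc : ∀ r, 0 ≤ r → P.real {ω | V ω ∈ Set.Icc (z - r) (z + r)} ≤ 2 * r + D) :
    |∫ ω, Y ω * sol z (V ω + Y ω) ∂P - (∫ ω, Y ω ^ 2 ∂P) * ∫ ω, solDeriv z (V ω) ∂P|
      ≤ 16 * ∫ ω, Y ω ^ 2 * min 1 |Y ω| ∂P + 4 * D * ∫ ω, Y ω ^ 2 ∂P := by
  have hgm := measurable_solDeriv z
  have hW : Measurable fun ω => V ω + Y ω := hV.add hY
  have hfm := (continuous_sol z).measurable
  have hYi := hY2.integrable one_le_two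
  have hfi : ∀ {U : Ω → ℝ}, Measurable U → Integrable (fun ω => Y ω * sol z (U ω)) P := fun hU =>
    hYi.mul_bdd (c := 6) (hfm.comp hU).aestronglyMeasurable
      (Eventually.of_forall fun ω => by
        rw [Real.norm_of_nonneg (sol_nonneg _ _)]; exact sol_le _ _)
  have hgi : Integrable (fun ω => Y ω ^ 2 * solDeriv z (V ω)) P :=
    hY2.integrable_sq.mul_bdd (c := 2) (hgm.comp hV).aestronglyMeasurable
      (Eventually.of_forall fun ω => abs_solDeriv_le z _)
  have hmi : Integrable (fun ω => Y ω ^ 2 * min 1 |Y ω|) P :=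
    hY2.integrable_sq.mul_bdd (c := 1) (by fun_prop)
      (Eventually.of_forall fun ω => by
        rw [Real.norm_of_nonneg (le_min zero_le_one (abs_nonneg _))]; exact min_le_left _ _)
  have hMi : Integrable (fun ω => Y ω ^ 2 * modulus z (V ω) (Y ω)) P := by
    have hind : IndepFun (fun ω => |V ω|) (fun ω => Y ω ^ 2) P :=
      hVY.comp (φ := fun v : ℝ => |v|) (ψ := fun y : ℝ => y ^ 2) (by fun_prop) (by fun_prop)
    have hp : Integrable (fun ω => |V ω| * Y ω ^ 2) P :=
      hind.integrable_mul (hV2.integrable one_le_two).abs hY2.integrable_sq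
    refine Integrable.mono' (g := fun ω => 10 * Y ω ^ 2 + 2 * (|V ω| * Y ω ^ 2))
      ((hY2.integrable_sq.const_mul 10).add (hp.const_mul 2))
      ((hY.pow_const 2).mul
        ((measurable_modulus z).comp (hV.prodMk hY))).aestronglyMeasurable
      (Eventually.of_forall fun ω => ?_)
    rw [Real.norm_of_nonneg (mul_nonneg (sq_nonneg _) (modulus_nonneg _ _ _))]
    have := mul_le_mul_of_nonneg_left (modulus_le z (V ω) (Y ω)) (sq_nonneg (Y ω))
    linarith
  have e1 : ∫ ω, Y ω * sol z (V ω) ∂P = 0 := by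
    have := hVY.symm.integral_fun_comp_mul_comp (f := id) (g := sol z) hY.aemeasurable
      hV.aemeasurable aestronglyMeasurable_id hfm.aestronglyMeasurable
    simp only [id] at this
    rw [this, hY0, zero_mul]
  have e2 : ∫ ω, Y ω ^ 2 * solDeriv z (V ω) ∂P
      = (∫ ω, Y ω ^ 2 ∂P) * ∫ ω, solDeriv z (V ω) ∂P :=
    hVY.symm.integral_fun_comp_mul_comp (f := fun y : ℝ => y ^ 2) (g := solDeriv z)
      hY.aemeasurable hV.aemeasurable (by fun_prop) hgm.aestronglyMeasurable
  have e3 : ∫ ω, Y ω * sol z (V ω + Y ω) ∂P - (∫ ω, Y ω ^ 2 ∂P) * ∫ ω, solDeriv z (V ω) ∂P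
      = ∫ ω, (Y ω * sol z (V ω + Y ω) - Y ω * sol z (V ω) - Y ω ^ 2 * solDeriv z (V ω)) ∂P := by
    have hd : Integrable (fun ω => Y ω * sol z (V ω + Y ω) - Y ω * sol z (V ω)) P :=
      (hfi hW).sub (hfi hV)
    rw [integral_sub hd hgi, integral_sub (hfi hW) (hfi hV),
      e1, e2, sub_zero]
  rw [e3]
  refine (abs_integral_le_integral_abs).trans ?_
  refine (integral_mono (((hfi hW).sub (hfi hV)).sub hgi).abs hMi fun ω => ?_).trans ?_
  · have h := mul_le_mul_of_nonneg_left (abs_sol_taylor_le z (V ω) (Y ω)) (abs_nonneg (Y ω))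
    rw [← abs_mul, ← mul_assoc, ← sq, sq_abs] at h
    refine le_trans (le_of_eq ?_) h
    simp only [Pi.sub_apply]
    congr 1
    ring
  refine (integral_le_of_indepFun hVY hV hY (e := fun q => q.2 ^ 2 * modulus z q.1 q.2)
    (h := fun x => x ^ 2 * (16 * min 1 |x| + 4 * D)) ((measurable_snd.pow_const 2).mul
      (measurable_modulus z)) hMi (by fun_prop) ?_ fun x => ?_).trans (le_of_eq ?_)
  · have := (hmi.const_mul 16).add (hY2.integrable_sq.const_mul (4 * D))
    refine this.congr (Eventually.of_forall fun ω => ?_)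
    simp only [Pi.add_apply]
    ring
  · simp only
    rw [integral_const_mul]
    exact mul_le_mul_of_nonneg_left (integral_modulus_le hV hV2 hV1 hD hconc x) (sq_nonneg x)
  · rw [← integral_const_mul, ← integral_const_mul, ← integral_add (hmi.const_mul 16)
      (hY2.integrable_sq.const_mul (4 * D))]
    refine integral_congr_ae (Eventually.of_forall fun ω => ?_)
    simp only
    ring

end BerryEsseen

namespace BerryEsseen
open SteinGaussian

variable {Ω : Type*} [MeasurableSpace Ω] {P : Measure Ω}
variable {ι : Type*} {X : ι → Ω → ℝ} {T : Finset ι}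

/-! ### The Berry–Esseen inequality -/

lemma min_one_abs_nonneg (x : ℝ) : 0 ≤ min 1 |x| := le_min zero_le_one (abs_nonneg x)

lemma integrable_sq_mul_min {Y : Ω → ℝ} (hY : Measurable Y) (hY2 : MemLp Y 2 P) :
    Integrable (fun ω => Y ω ^ 2 * min 1 |Y ω|) P :=
  hY2.integrable_sq.mul_bdd (c := 1) (by fun_prop) (Eventually.of_forall fun ω => by
    rw [Real.norm_of_nonneg (min_one_abs_nonneg _)]; exact min_le_left _ _)

variable [IsProbabilityMeasure P]

/-- Values with |Y| ≤ 1/8 contribute less than 1/8. When the total truncated moment is at most 1/64,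
no single variance therefore exceeds 1/4, so removing one summand leaves variance at least 3/4. -/
lemma integral_sq_le {Y : Ω → ℝ} (hY : Measurable Y) (hY2 : MemLp Y 2 P) :
    ∫ ω, Y ω ^ 2 ∂P ≤ 1 / 8 + 8 * ∫ ω, Y ω ^ 2 * min 1 |Y ω| ∂P := by
  have hi := integrable_sq_mul_min hY hY2
  have h : ∫ ω, Y ω ^ 2 ∂P ≤ ∫ ω, (1 / 8 + 8 * (Y ω ^ 2 * min 1 |Y ω|)) ∂P := by
    refine integral_mono hY2.integrable_sq ((integrable_const _).add (hi.const_mul 8)) fun ω => ?_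
    simp only
    rcases le_total |Y ω| (1 / 8) with h | h
    · have h1 : Y ω ^ 2 ≤ 1 / 8 := by
        rw [← sq_abs]; nlinarith [abs_nonneg (Y ω)]
      have := mul_nonneg (sq_nonneg (Y ω)) (min_one_abs_nonneg (Y ω))
      linarith
    · have h1 : 1 / 8 ≤ min 1 |Y ω| := le_min (by norm_num) h
      have := mul_le_mul_of_nonneg_left h1 (sq_nonneg (Y ω))
      linarith
  rw [integral_add (integrable_const _) (hi.const_mul 8), integral_const_mul] at h
  simpa using h

/-- A truncated form of E Y² · E|Y| ≤ E|Y|³. With σ² = E Y², the first absolute moment is at most σ.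
Values with |Y| ≤ σ/2 carry at most a quarter of the second moment, so σ³ is controlled by the
truncated moment. -/
lemma integral_sq_mul_integral_min_le {Y : Ω → ℝ} (hY : Measurable Y) (hY2 : MemLp Y 2 P)
    (h1 : ∫ ω, Y ω ^ 2 ∂P ≤ 1) :
    (∫ ω, Y ω ^ 2 ∂P) * ∫ ω, min 1 |Y ω| ∂P ≤ 8 / 3 * ∫ ω, Y ω ^ 2 * min 1 |Y ω| ∂P := by
  have hi := integrable_sq_mul_min hY hY2
  have hβ : 0 ≤ ∫ ω, Y ω ^ 2 * min 1 |Y ω| ∂P :=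
    integral_nonneg fun ω => mul_nonneg (sq_nonneg _) (min_one_abs_nonneg _)
  have hs : 0 ≤ ∫ ω, Y ω ^ 2 ∂P := integral_nonneg fun ω => sq_nonneg _
  set s := ∫ ω, Y ω ^ 2 ∂P with hsdef
  set β := ∫ ω, Y ω ^ 2 * min 1 |Y ω| ∂P with hβdef
  rcases hs.eq_or_lt with h | hpos
  · rw [← h, zero_mul]; positivity
  set σ := √s with hσ
  have hσ0 : 0 < σ := Real.sqrt_pos.2 hpos
  have hσs : σ ^ 2 = s := Real.sq_sqrt hs
  have hσ1 : σ ≤ 1 := Real.sqrt_le_one.2 h1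
  have hA : ∫ ω, min 1 |Y ω| ∂P ≤ σ := by
    have h : ∫ ω, min 1 |Y ω| ∂P ≤ ∫ ω, (σ / 2 + Y ω ^ 2 / (2 * σ)) ∂P := by
      refine integral_mono (Integrable.of_bound (by fun_prop) 1 (Eventually.of_forall fun ω => by
          rw [Real.norm_of_nonneg (min_one_abs_nonneg _)]; exact min_le_left _ _))
        ((integrable_const _).add (hY2.integrable_sq.div_const _)) fun ω => ?_
      refine (min_le_right _ _).trans ?_
      have h := sq_nonneg (|Y ω| - σ)
      rw [sub_sq, sq_abs] at h
      have e : σ / 2 + Y ω ^ 2 / (2 * σ) = (σ ^ 2 + Y ω ^ 2) / (2 * σ) := by field_simp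
      simp only
      rw [e, le_div_iff₀ (by positivity)]
      linarith
    rw [integral_add (integrable_const _) (hY2.integrable_sq.div_const _),
      integral_div (2 * σ) fun ω => Y ω ^ 2, ← hsdef, ← hσs] at h
    simp only [integral_const, probReal_univ, one_smul] at h
    have e : σ ^ 2 / (2 * σ) = σ / 2 := by field_simp
    linarith
  have hB : s ≤ s / 4 + 2 / σ * β := by
    have h : ∫ ω, Y ω ^ 2 ∂P ≤ ∫ ω, (s / 4 + 2 / σ * (Y ω ^ 2 * min 1 |Y ω|)) ∂P := by
      refine integral_mono hY2.integrable_sq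
        ((integrable_const _).add (hi.const_mul (2 / σ))) fun ω => ?_
      simp only
      rcases le_total |Y ω| (σ / 2) with h | h
      · have h1 : Y ω ^ 2 ≤ s / 4 := by
          rw [← sq_abs, ← hσs]; nlinarith [abs_nonneg (Y ω)]
        have := mul_nonneg (by positivity : 0 ≤ 2 / σ)
          (mul_nonneg (sq_nonneg (Y ω)) (min_one_abs_nonneg (Y ω)))
        linarith
      · have h1 : σ / 2 ≤ min 1 |Y ω| := le_min (by linarith) h
        have h2 := mul_le_mul_of_nonneg_left
          (mul_le_mul_of_nonneg_left h1 (sq_nonneg (Y ω))) (by positivity : 0 ≤ 2 / σ)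
        have e : 2 / σ * (Y ω ^ 2 * (σ / 2)) = Y ω ^ 2 := by field_simp
        linarith
    rw [integral_add (integrable_const _) (hi.const_mul (2 / σ)), integral_const_mul,
      ← hβdef] at h
    simpa using h
  have hC : s * σ ≤ 8 / 3 * β := by
    have h : (3 / 4 * s) * σ ≤ (2 / σ * β) * σ := mul_le_mul_of_nonneg_right (by linarith) hσ0.le
    have e : (2 / σ * β) * σ = 2 * β := by field_simp
    linarith
  exact (mul_le_mul_of_nonneg_left hA hs).trans hC

lemma integral_sq_sub_le {Y : Ω → ℝ} (hY : Measurable Y) (hY2 : MemLp Y 2 P) {δ : ℝ}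
    (hδ : 0 < δ) (hδ1 : δ ≤ 1) :
    ∫ ω, Y ω ^ 2 ∂P - (∫ ω, Y ω ^ 2 * min 1 |Y ω| ∂P) / δ ≤ ∫ ω, |Y ω| * min δ |Y ω| ∂P := by
  have hi := integrable_sq_mul_min hY hY2
  rw [← integral_div, ← integral_sub hY2.integrable_sq (hi.div_const δ)]
  refine integral_mono (hY2.integrable_sq.sub (hi.div_const δ)) ?_ fun ω => ?_
  · exact (hY2.integrable one_le_two).abs.mul_bdd (c := δ) (by fun_prop)
      (Eventually.of_forall fun ω => by
        rw [Real.norm_of_nonneg (le_min hδ.le (abs_nonneg _))]; exact min_le_left _ _)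
  · simp only
    rcases le_total |Y ω| δ with h | h
    · rw [min_eq_right h, ← sq, sq_abs]
      have := div_nonneg (mul_nonneg (sq_nonneg (Y ω)) (min_one_abs_nonneg (Y ω))) hδ.le
      linarith
    · have h1 : δ ≤ min 1 |Y ω| := le_min hδ1 h
      have h2 : Y ω ^ 2 ≤ Y ω ^ 2 * min 1 |Y ω| / δ := by
        rw [le_div_iff₀ hδ]
        exact mul_le_mul_of_nonneg_left h1 (sq_nonneg _)
      have : 0 ≤ |Y ω| * min δ |Y ω| := mul_nonneg (abs_nonneg _) (le_min hδ.le (abs_nonneg _))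
      linarith

lemma leave_one_out_concentration [DecidableEq ι] (hm : ∀ i, Measurable (X i))
    (hi : iIndepFun X P) (h2 : ∀ i ∈ T, MemLp (X i) 2 P) (h0 : ∀ i ∈ T, ∫ ω, X i ω ∂P = 0)
    (hv : ∑ i ∈ T, ∫ ω, X i ω ^ 2 ∂P = 1) {B : ℝ} (hB0 : 0 < B) (hB1 : B ≤ 1 / 64)
    (hB : ∑ i ∈ T, ∫ ω, X i ω ^ 2 * min 1 |X i ω| ∂P ≤ B) {i : ι} (hiT : i ∈ T) (z : ℝ)
    {r : ℝ} (hr : 0 ≤ r) :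
    P.real {ω | ∑ j ∈ T.erase i, X j ω ∈ Set.Icc (z - r) (z + r)} ≤ 2 * r + 16 * B := by
  have hβ0 : ∀ j, 0 ≤ ∫ ω, X j ω ^ 2 * min 1 |X j ω| ∂P := fun j =>
    integral_nonneg fun ω => mul_nonneg (sq_nonneg _) (min_one_abs_nonneg _)
  have hs0 : ∀ j, 0 ≤ ∫ ω, X j ω ^ 2 ∂P := fun j => integral_nonneg fun ω => sq_nonneg _
  have hmem : ∀ j ∈ T.erase i, j ∈ T := fun j hj => Finset.mem_of_mem_erase hj
  have hvs := Finset.sum_erase_add T (fun i => ∫ ω, X i ω ^ 2 ∂P) hiT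
  have hBs := Finset.sum_erase_add T (fun i => ∫ ω, X i ω ^ 2 * min 1 |X i ω| ∂P) hiT
  -- With δ = 4B the truncation loses at most 1/4 of a variance that is at least 3/4. The factor
  -- next to the probability is then at least 1/2, and r + 8B doubles to 2r + 16B.
  have hc := concentration (T := T.erase i) hm hi (fun j hj => h2 j (hmem j hj))
    (fun j hj => h0 j (hmem j hj)) (by linarith [hs0 i]) (a := z - r) (b := z + r) (δ := 4 * B)
    (by linarith) (by linarith)
  have hle : ∑ j ∈ T.erase i,
      (∫ ω, X j ω ^ 2 ∂P - (∫ ω, X j ω ^ 2 * min 1 |X j ω| ∂P) / (4 * B))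
      ≤ ∑ j ∈ T.erase i, ∫ ω, |X j ω| * min (4 * B) |X j ω| ∂P :=
    Finset.sum_le_sum fun j hj => integral_sq_sub_le (hm j) (h2 j (hmem j hj)) (by linarith)
      (by linarith)
  rw [Finset.sum_sub_distrib, ← Finset.sum_div] at hle
  have hsum : 0 ≤ ∑ j ∈ T.erase i, ∫ ω, X j ω ^ 2 * min 1 |X j ω| ∂P :=
    Finset.sum_nonneg fun j _ => hβ0 j
  have hdiv : (∑ j ∈ T.erase i, ∫ ω, X j ω ^ 2 * min 1 |X j ω| ∂P) / (4 * B) ≤ 1 / 4 := by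
    rw [div_le_iff₀ (by linarith)]
    linarith [hβ0 i]
  have hsi := integral_sq_le (hm i) (h2 i hiT)
  have hhalf : 1 / 2 ≤ ∑ j ∈ T.erase i, ∫ ω, |X j ω| * min (4 * B) |X j ω| ∂P := by linarith
  have := mul_le_mul_of_nonneg_left hhalf
    (measureReal_nonneg (μ := P) (s := {ω | ∑ j ∈ T.erase i, X j ω ∈ Set.Icc (z - r) (z + r)}))
  linarith

/-- **Berry–Esseen inequality** for independent centred square-integrable summands of total
variance one. -/
theorem berry_esseen (hm : ∀ i, Measurable (X i)) (hi : iIndepFun X P)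
    (h2 : ∀ i ∈ T, MemLp (X i) 2 P) (h0 : ∀ i ∈ T, ∫ ω, X i ω ∂P = 0)
    (hv : ∑ i ∈ T, ∫ ω, X i ω ^ 2 ∂P = 1) {B : ℝ} (hB0 : 0 < B)
    (hB : ∑ i ∈ T, ∫ ω, X i ω ^ 2 * min 1 |X i ω| ∂P ≤ B) (z : ℝ) :
    |P.real {ω | ∑ i ∈ T, X i ω ≤ z} - Phi z| ≤ 200 * B := by
  classical
  -- For B > 1/64 the right-hand side exceeds 1 and there is nothing to prove.
  rcases lt_or_ge (1 / 64) B with hB1 | hB1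
  · have e1 : P.real {ω | ∑ i ∈ T, X i ω ≤ z} ≤ 1 := measureReal_le_one
    have e2 : 0 ≤ P.real {ω | ∑ i ∈ T, X i ω ≤ z} := measureReal_nonneg
    have := Phi_nonneg z
    have := Phi_le_one z
    rw [abs_le]; constructor <;> linarith
  set W : Ω → ℝ := fun ω => ∑ i ∈ T, X i ω with hW
  have hWm : Measurable W := Finset.measurable_sum _ fun i _ => hm i
  have hfm := (continuous_sol z).measurable
  have hgm := measurable_solDeriv z
  set G := ∫ ω, solDeriv z (W ω) ∂P with hG
  have hXf : ∀ i ∈ T, Integrable (fun ω => X i ω * sol z (W ω)) P := fun i hiT =>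
    ((h2 i hiT).integrable one_le_two).mul_bdd (c := 6) (hfm.comp hWm).aestronglyMeasurable
      (Eventually.of_forall fun ω => by
        rw [Real.norm_of_nonneg (sol_nonneg _ _)]; exact sol_le _ _)
  -- The constants: 16 · 8/3 + 16 ≤ 60, and 128 = 2 · 4 · 16 from the two uses of the concentration
  -- error 16B. As the variances sum to 1, the total is 188B.
  have hterm : ∀ i ∈ T, |(∫ ω, X i ω ^ 2 ∂P) * G - ∫ ω, X i ω * sol z (W ω) ∂P|
      ≤ 60 * ∫ ω, X i ω ^ 2 * min 1 |X i ω| ∂P + 128 * B * ∫ ω, X i ω ^ 2 ∂P := by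
    intro i hiT
    set V : Ω → ℝ := fun ω => ∑ j ∈ T.erase i, X j ω with hV
    have hVm : Measurable V := Finset.measurable_sum _ fun i _ => hm i
    have hmem : ∀ j ∈ T.erase i, j ∈ T := fun j hj => Finset.mem_of_mem_erase hj
    have hV2 : MemLp V 2 P := memLp_sum fun j hj => h2 j (hmem j hj)
    have hs0 : ∀ j, 0 ≤ ∫ ω, X j ω ^ 2 ∂P := fun j => integral_nonneg fun ω => sq_nonneg _
    have hvs := Finset.sum_erase_add T (fun i => ∫ ω, X i ω ^ 2 ∂P) hiT
    have hV1 : ∫ ω, V ω ^ 2 ∂P ≤ 1 := by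
      rw [hV, integral_sq_sum hi (fun j hj => h2 j (hmem j hj)) fun j hj => h0 j (hmem j hj)]
      linarith [hs0 i]
    have hsi1 : ∫ ω, X i ω ^ 2 ∂P ≤ 1 := by
      have := Finset.sum_nonneg fun j (_ : j ∈ T.erase i) => hs0 j
      linarith
    have hWV : ∀ ω, W ω = V ω + X i ω := fun ω => by
      simp only [hW, hV]
      rw [Finset.sum_erase_add _ _ hiT]
    have hVX : IndepFun V (X i) P := indepFun_sum_erase hm hi i
    have hconc : ∀ r, 0 ≤ r → P.real {ω | V ω ∈ Set.Icc (z - r) (z + r)} ≤ 2 * r + 16 * B :=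
      fun r hr => leave_one_out_concentration hm hi h2 h0 hv hB0 hB1 hB hiT z hr
    have hA := abs_integral_solDeriv_sub_le (z := z) hVX hVm (hm i) hV2 hV1 (by linarith) hconc
    have hC := abs_integral_mul_sol_sub_le (z := z) hVX hVm (hm i) hV2 hV1 (h2 i hiT) (h0 i hiT)
      (by linarith) hconc
    simp only [← hWV] at hA hC
    rw [← hG] at hA
    set s := ∫ ω, X i ω ^ 2 ∂P
    set g := ∫ ω, solDeriv z (V ω) ∂P
    set F := ∫ ω, X i ω * sol z (W ω) ∂P
    have hE := integral_sq_mul_integral_min_le (hm i) (h2 i hiT) hsi1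
    have hβ : 0 ≤ ∫ ω, X i ω ^ 2 * min 1 |X i ω| ∂P :=
      integral_nonneg fun ω => mul_nonneg (sq_nonneg _) (min_one_abs_nonneg _)
    have e : s * G - F = s * (G - g) - (F - s * g) := by ring
    have h3 : |s * (G - g)| ≤ s * (16 * ∫ ω, min 1 |X i ω| ∂P + 4 * (16 * B)) := by
      rw [abs_mul, abs_of_nonneg (hs0 i)]
      exact mul_le_mul_of_nonneg_left hA (hs0 i)
    rw [e]
    refine (abs_sub _ _).trans ?_
    linarith
  have hWf : ∫ ω, W ω * sol z (W ω) ∂P = ∑ i ∈ T, ∫ ω, X i ω * sol z (W ω) ∂P := by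
    rw [← integral_finsetSum _ hXf]
    refine integral_congr_ae (Eventually.of_forall fun ω => ?_)
    simp only [← Finset.sum_mul]; rfl
  have hWfi : Integrable (fun ω => W ω * sol z (W ω)) P :=
    Integrable.of_bound (hWm.mul (hfm.comp hWm)).aestronglyMeasurable 1
      (Eventually.of_forall fun ω => abs_mul_sol_le z _)
  have hAm : MeasurableSet {ω | W ω ≤ z} := hWm measurableSet_Iic
  have hIi : Integrable ({ω | W ω ≤ z}.indicator (1 : Ω → ℝ)) P :=
    (integrable_const (1 : ℝ)).indicator hAm
  -- Stein's equation, integrated at W.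
  have hstein : P.real {ω | W ω ≤ z} - Phi z = G - ∫ ω, W ω * sol z (W ω) ∂P := by
    have e : G = ∫ ω, (W ω * sol z (W ω) + ({ω | W ω ≤ z}.indicator 1 ω - Phi z)) ∂P := rfl
    have hIc : Integrable (fun ω => {ω | W ω ≤ z}.indicator (1 : Ω → ℝ) ω - Phi z) P :=
      hIi.sub (integrable_const _)
    rw [e, integral_add hWfi hIc, integral_sub hIi (integrable_const _),
      integral_indicator_one hAm]
    simp
  have hsum : G - ∫ ω, W ω * sol z (W ω) ∂P
      = ∑ i ∈ T, ((∫ ω, X i ω ^ 2 ∂P) * G - ∫ ω, X i ω * sol z (W ω) ∂P) := by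
    rw [Finset.sum_sub_distrib, ← Finset.sum_mul, hv, one_mul, hWf]
  rw [hstein, hsum]
  refine (Finset.abs_sum_le_sum_abs _ _).trans ((Finset.sum_le_sum hterm).trans ?_)
  rw [Finset.sum_add_distrib, ← Finset.mul_sum, ← Finset.mul_sum, hv]
  linarith

end BerryEsseen

/-! ### Propagation of small errors along an orbit -/

namespace OrbitError

variable {F : ℝ → ℝ} {x : ℝ}

lemma differentiableAt_iterate (hd : ∀ i, DifferentiableAt ℝ F (F^[i] x)) (m j : ℕ) :
    DifferentiableAt ℝ (F^[m]) (F^[j] x) := by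
  induction m with
  | zero => exact differentiableAt_id
  | succ m ih =>
    rw [Function.iterate_succ']
    refine DifferentiableAt.comp _ ?_ ih
    rw [← Function.iterate_add_apply]
    exact hd _

lemma deriv_iterate_succ (hd : ∀ i, DifferentiableAt ℝ F (F^[i] x)) {n j : ℕ} (h : j ≤ n) :
    deriv (F^[n + 1 - j]) (F^[j] x) = deriv F (F^[n] x) * deriv (F^[n - j]) (F^[j] x) := by
  rw [Nat.succ_sub h, Function.iterate_succ']
  have e : F^[n - j] (F^[j] x) = F^[n] x := by
    rw [← Function.iterate_add_apply, Nat.sub_add_cancel h]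
  rw [deriv_comp _ (by rw [e]; exact hd n) (differentiableAt_iterate hd _ _), e]

lemma deriv_iterate_self (n : ℕ) : deriv (F^[n - n]) (F^[n] x) = 1 := by
  simp

/-- Variation of constants for the linearized recursion. -/
lemma eq_sum_of_recursion (hd : ∀ i, DifferentiableAt ℝ F (F^[i] x)) {e b : ℕ → ℝ} (h0 : e 0 = 0)
    (hs : ∀ m, e (m + 1) = deriv F (F^[m] x) * e m + b (m + 1)) (n : ℕ) :
    e n = ∑ j ∈ Finset.Icc 1 n, deriv (F^[n - j]) (F^[j] x) * b j := by
  induction n with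
  | zero => simp [h0]
  | succ n ih =>
    rw [Finset.sum_Icc_succ_top (by omega), deriv_iterate_self, one_mul, hs, ih, Finset.mul_sum]
    congr 1
    refine Finset.sum_congr rfl fun j hj => ?_
    rw [deriv_iterate_succ hd (Finset.mem_Icc.1 hj).2, mul_assoc]

lemma abs_sum_mul_le {ι : Type*} {s : Finset ι} {a b : ι → ℝ} {H β : ℝ} (hβ : 0 ≤ β)
    (ha : ∑ j ∈ s, |a j| ≤ H) (hb : ∀ j ∈ s, |b j| ≤ β) : |∑ j ∈ s, a j * b j| ≤ H * β := by
  refine (Finset.abs_sum_le_sum_abs _ _).trans ?_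
  calc ∑ j ∈ s, |a j * b j| ≤ ∑ j ∈ s, |a j| * β := Finset.sum_le_sum fun j hj => by
        rw [abs_mul]; exact mul_le_mul_of_nonneg_left (hb j hj) (abs_nonneg _)
    _ = (∑ j ∈ s, |a j|) * β := by rw [Finset.sum_mul]
    _ ≤ H * β := mul_le_mul_of_nonneg_right ha hβ

/-- If the noise is small, then the deviation of the noisy orbit is linear in the noise up to a
quadratic error. -/
theorem abs_deviation_sub_le (hd : ∀ i, DifferentiableAt ℝ F (F^[i] x)) {X ξ : ℕ → ℝ} {σ H η K : ℝ}
    {n : ℕ} (hX0 : X 0 = x) (hX : ∀ m, X (m + 1) = F (X m) + σ * ξ (m + 1)) (hσ : 0 ≤ σ)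
    (hη : 0 ≤ η) (hH0 : 0 ≤ H) (hK : 0 ≤ K)
    (hH : ∀ m ≤ n, ∑ j ∈ Finset.Icc 1 m, |deriv (F^[m - j]) (F^[j] x)| ≤ H)
    (hξ : ∀ j ∈ Finset.Icc 1 n, |ξ j| ≤ η)
    (hT : ∀ m < n, |F (X m) - F (F^[m] x) - deriv F (F^[m] x) * (X m - F^[m] x)|
      ≤ K * (X m - F^[m] x) ^ 2)
    (hsmall : 4 * K * σ * H ^ 2 * η ≤ 1) :
    |X n - F^[n] x - σ * ∑ j ∈ Finset.Icc 1 n, deriv (F^[n - j]) (F^[j] x) * ξ j|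
      ≤ 4 * K * σ ^ 2 * H ^ 3 * η ^ 2 := by
  set e : ℕ → ℝ := fun m => X m - F^[m] x with he
  set r : ℕ → ℝ := fun m => F (X m) - F (F^[m] x) - deriv F (F^[m] x) * e m with hr
  -- The Taylor remainder at time j − 1 enters the recursion like additional noise at time j.
  have hrec : ∀ m, e m = ∑ j ∈ Finset.Icc 1 m,
      deriv (F^[m - j]) (F^[j] x) * (r (j - 1) + σ * ξ j) := by
    refine eq_sum_of_recursion hd (b := fun j => r (j - 1) + σ * ξ j) (by simp [he, hX0])
      fun m => ?_
    simp only [he, hr, hX, Function.iterate_succ_apply', Nat.add_sub_cancel]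
    ring
  -- Bootstrap: if all earlier deviations are at most 2σHη, then by `hsmall` each remainder is at
  -- most ση, no more than the noise itself, and the bound reproduces itself.
  have hbound : ∀ m ≤ n, |e m| ≤ 2 * σ * H * η := by
    intro m
    induction m using Nat.strong_induction_on with
    | _ m ih =>
      intro hm
      rw [hrec m]
      have h1 : |∑ j ∈ Finset.Icc 1 m, deriv (F^[m - j]) (F^[j] x) * (r (j - 1) + σ * ξ j)|
          ≤ H * (K * (2 * σ * H * η) ^ 2 + σ * η) := by
        refine abs_sum_mul_le (by positivity) (hH m hm) fun j hj => ?_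
        obtain ⟨hj1, hjm⟩ := Finset.mem_Icc.1 hj
        refine (abs_add_le _ _).trans (add_le_add ?_ ?_)
        · refine (hT (j - 1) (by omega)).trans (mul_le_mul_of_nonneg_left ?_ hK)
          exact sq_le_sq.2 ((ih (j - 1) (by omega) (by omega)).trans (le_abs_self _))
        · rw [abs_mul, abs_of_nonneg hσ]
          exact mul_le_mul_of_nonneg_left (hξ j (Finset.mem_Icc.2 ⟨hj1, hjm.trans hm⟩)) hσ
      have h2 : H * (K * (2 * σ * H * η) ^ 2 + σ * η)
          = σ * H * η * (4 * K * σ * H ^ 2 * η + 1) := by ring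
      have h3 : σ * H * η * (4 * K * σ * H ^ 2 * η + 1) ≤ σ * H * η * 2 :=
        mul_le_mul_of_nonneg_left (by linarith) (by positivity)
      linarith
  have hfin : X n - F^[n] x - σ * ∑ j ∈ Finset.Icc 1 n, deriv (F^[n - j]) (F^[j] x) * ξ j
      = ∑ j ∈ Finset.Icc 1 n, deriv (F^[n - j]) (F^[j] x) * r (j - 1) := by
    have h := hrec n
    simp only [mul_add, Finset.sum_add_distrib] at h
    rw [Finset.mul_sum]
    change e n - _ = _
    rw [h, add_sub_assoc, add_eq_left, sub_eq_zero]
    refine Finset.sum_congr rfl fun j _ => ?_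
    ring
  rw [hfin]
  refine (abs_sum_mul_le (β := K * (2 * σ * H * η) ^ 2) (by positivity) (hH n le_rfl)
    fun j hj => ?_).trans (le_of_eq (by ring))
  obtain ⟨hj1, hjm⟩ := Finset.mem_Icc.1 hj
  refine (hT (j - 1) (by omega)).trans (mul_le_mul_of_nonneg_left ?_ hK)
  exact sq_le_sq.2 ((hbound (j - 1) (by omega)).trans (le_abs_self _))

/-- A first-order Taylor estimate on a convex set. -/
lemma abs_taylor_le {f f' : ℝ → ℝ} {s : Set ℝ} (hs : Convex ℝ s) {K : ℝ}
    (hf : ∀ t ∈ s, HasDerivWithinAt f (f' t) s t)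
    (hf' : ∀ u ∈ s, ∀ v ∈ s, |f' u - f' v| ≤ K * |u - v|) (hK : 0 ≤ K) {u v : ℝ} (hu : u ∈ s)
    (hv : v ∈ s) : |f u - f v - f' v * (u - v)| ≤ K * (u - v) ^ 2 := by
  have hsub : Set.uIcc v u ⊆ s := hs.ordConnected.uIcc_subset hv hu
  have h := Convex.norm_image_sub_le_of_norm_hasDerivWithin_le (f := fun t => f t - f' v * t)
    (f' := fun t => f' t - f' v) (s := Set.uIcc v u) (C := K * |u - v|) (x := v) (y := u)
    (fun t ht => by
      have := ((hf t (hsub ht)).mono hsub).sub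
        ((hasDerivWithinAt_id t (Set.uIcc v u)).const_mul (f' v))
      rw [mul_one] at this
      exact this)
    (fun t ht => by
      refine (hf' t (hsub ht) v hv).trans (mul_le_mul_of_nonneg_left ?_ hK)
      exact Set.abs_sub_left_of_mem_uIcc ht)
    (convex_uIcc v u) Set.left_mem_uIcc Set.right_mem_uIcc
  simp only [Real.norm_eq_abs] at h
  rw [mul_assoc, ← sq, sq_abs] at h
  have e : f u - f v - f' v * (u - v) = f u - f' v * u - (f v - f' v * v) := by ring
  rw [e]; exact h

end OrbitError

/-! ### Taylor estimates for the map along noisy orbits -/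

namespace OneDimMap

open OrbitError

variable {Ω : Type*}

lemma abs_le_maxNoise (ξ : ℕ → Ω → ℝ) {n j : ℕ} (hj : j ∈ Finset.Icc 1 n) (ω : Ω) :
    |ξ j ω| ≤ maxNoise ξ n ω := by
  have : ‖ξ j ω‖₊ ≤ (Finset.Icc 1 n).sup fun j => ‖ξ j ω‖₊ :=
    Finset.le_sup (f := fun j => ‖ξ j ω‖₊) hj
  exact_mod_cast this

lemma maxNoise_nonneg (ξ : ℕ → Ω → ℝ) (n : ℕ) (ω : Ω) : 0 ≤ maxNoise ξ n ω := NNReal.coe_nonneg _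

lemma iterate_mem_domain (S : OneDimMap) {x : ℝ} (hx : x ∈ S.domain) (i : ℕ) :
    S.toFun^[i] x ∈ S.domain := by
  cases S with
  | line f hf => trivial
  | circle f F hF hl => trivial
  | interval a ha f hf hm =>
    induction i with
    | zero => exact hx
    | succ i ih =>
      rw [Function.iterate_succ_apply']
      refine hm ?_
      obtain ⟨h1, h2⟩ := ih
      exact ⟨by linarith, by linarith⟩

lemma differentiableAt_toFun (S : OneDimMap) {y : ℝ} (hy : y ∈ S.domain) :
    DifferentiableAt ℝ S.toFun y := by
  cases S with
  | line f hf => exact (hf.differentiable two_ne_zero).differentiableAt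
  | circle f F hF hl => exact (hF.differentiable two_ne_zero).differentiableAt
  | interval a ha f hf hm =>
    obtain ⟨h1, h2⟩ := hy
    exact (hf.differentiableOn two_ne_zero).differentiableAt
      (Icc_mem_nhds (by linarith) (by linarith))

lemma differentiableAt_orbit (S : OneDimMap) {x : ℝ} (hx : x ∈ S.domain) (i : ℕ) :
    DifferentiableAt ℝ S.toFun (S.toFun^[i] x) :=
  S.differentiableAt_toFun (S.iterate_mem_domain hx i)

lemma abs_deriv_deriv_le (S : OneDimMap) (hL : S.secondDerivNorm ≠ ⊤) {y : ℝ} (hy : y ∈ S.domain) :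
    |deriv (deriv S.toFun) y| ≤ S.secondDerivNorm.toReal := by
  have h : ENNReal.ofReal |deriv (deriv S.toFun) y| ≤ S.secondDerivNorm :=
    le_iSup₂ (f := fun y (_ : y ∈ S.domain) => ENNReal.ofReal |deriv (deriv S.toFun) y|) y hy
  exact (ENNReal.ofReal_le_iff_le_toReal hL).1 h

lemma taylor_of_contDiff {F : ℝ → ℝ} (hF : ContDiff ℝ 2 F) {K : ℝ}
    (hK : ∀ y, |deriv (deriv F) y| ≤ K) (u v : ℝ) :
    |F u - F v - deriv F v * (u - v)| ≤ K * (u - v) ^ 2 := by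
  have hF1 : Differentiable ℝ F := hF.differentiable two_ne_zero
  have hF2 : Differentiable ℝ (deriv F) :=
    (contDiff_succ_iff_deriv.1 (show ContDiff ℝ (1 + 1) F from hF)).2.2.differentiable one_ne_zero
  refine abs_taylor_le convex_univ (f' := deriv F)
    (fun t _ => (hF1 t).hasDerivAt.hasDerivWithinAt) (fun u hu v hv => ?_)
    ((abs_nonneg _).trans (hK 0)) (Set.mem_univ u) (Set.mem_univ v)
  exact convex_univ.norm_image_sub_le_of_norm_hasDerivWithin_le
    (fun t _ => (hF2 t).hasDerivAt.hasDerivWithinAt) (fun t _ => hK t) hv hu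

/-- The noisy point u may lie outside [-1, 1], so the bound on the second derivative comes from
compactness of the larger interval. Derivatives within that interval are used because f is arbitrary
outside; at v, an interior point, they agree with `deriv`. -/
lemma exists_taylor_of_contDiffOn {a : ℝ} (ha : 0 < a) {f : ℝ → ℝ}
    (hf : ContDiffOn ℝ 2 f (Set.Icc (-1 - a) (1 + a))) :
    ∃ K, 0 ≤ K ∧ ∀ u ∈ Set.Icc (-1 - a) (1 + a), ∀ v ∈ Set.Icc (-1 : ℝ) 1,
      |f u - f v - deriv f v * (u - v)| ≤ K * (u - v) ^ 2 := by
  set s := Set.Icc (-1 - a) (1 + a) with hsdef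
  have hu : UniqueDiffOn ℝ s := uniqueDiffOn_Icc (by linarith)
  have h1 : DifferentiableOn ℝ f s := hf.differentiableOn two_ne_zero
  have hf' : ContDiffOn ℝ 1 (derivWithin f s) s := hf.derivWithin hu (by norm_num)
  have h2 : DifferentiableOn ℝ (derivWithin f s) s := hf'.differentiableOn one_ne_zero
  have h3 : ContinuousOn (derivWithin (derivWithin f s) s) s :=
    hf'.continuousOn_derivWithin hu le_rfl
  obtain ⟨K, hK⟩ := isCompact_Icc.exists_bound_of_continuousOn h3
  refine ⟨max K 0, le_max_right _ _, fun u hu v hv => ?_⟩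
  have hvs : s ∈ 𝓝 v := Icc_mem_nhds (by linarith [hv.1]) (by linarith [hv.2])
  rw [← derivWithin_of_mem_nhds hvs]
  refine abs_taylor_le (convex_Icc _ _) (fun t ht => (h1 t ht).hasDerivWithinAt)
    (fun u hu v hv => ?_) (le_max_right _ _) hu (mem_of_mem_nhds hvs)
  exact (convex_Icc _ _).norm_image_sub_le_of_norm_hasDerivWithin_le
    (fun t ht => (h2 t ht).hasDerivWithinAt) (fun t ht => (hK t ht).trans (le_max_left _ _)) hv hu

/-- An affine map that sends a neighbourhood of `[-1, 1]` into `[-1, 1]` is a contraction. -/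
lemma exists_slope_of_deriv_deriv_eq_zero {a : ℝ} (ha : 0 < a) {f : ℝ → ℝ}
    (hf : ContDiffOn ℝ 2 f (Set.Icc (-1 - a) (1 + a)))
    (hm : Set.MapsTo f (Set.Icc (-1 - a) (1 + a)) (Set.Icc (-1) 1))
    (h0 : ∀ y ∈ Set.Icc (-1 : ℝ) 1, deriv (deriv f) y = 0) :
    ∃ l : ℝ, l ^ 2 < 1 ∧ ∀ y ∈ Set.Icc (-1 : ℝ) 1, deriv f y = l := by
  have hsub : Set.Icc (-1 : ℝ) 1 ⊆ Set.Ioo (-1 - a) (1 + a) := fun y hy =>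
    ⟨by linarith [hy.1], by linarith [hy.2]⟩
  have hfo : ContDiffOn ℝ 2 f (Set.Ioo (-1 - a) (1 + a)) := hf.mono Set.Ioo_subset_Icc_self
  have hd : ∀ y ∈ Set.Icc (-1 : ℝ) 1, DifferentiableAt ℝ f y := fun y hy =>
    (hfo.differentiableOn two_ne_zero).differentiableAt (isOpen_Ioo.mem_nhds (hsub hy))
  have hd2 : ∀ y ∈ Set.Icc (-1 : ℝ) 1, DifferentiableAt ℝ (deriv f) y := fun y hy =>
    ((hfo.deriv_of_isOpen (m := 1) isOpen_Ioo (by norm_num)).differentiableOn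
      one_ne_zero).differentiableAt (isOpen_Ioo.mem_nhds (hsub hy))
  have h1m : (1 : ℝ) ∈ Set.Icc (-1 : ℝ) 1 := by norm_num
  have h2m : (-1 : ℝ) ∈ Set.Icc (-1 : ℝ) 1 := by norm_num
  have hconst : ∀ y ∈ Set.Icc (-1 : ℝ) 1, deriv f y = deriv f 1 := by
    intro y hy
    have := (convex_Icc (-1 : ℝ) 1).norm_image_sub_le_of_norm_hasDerivWithin_le (C := 0)
      (fun t ht => (hd2 t ht).hasDerivAt.hasDerivWithinAt) (fun t ht => by rw [h0 t ht]; simp)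
      h1m hy
    rw [zero_mul] at this
    exact sub_eq_zero.1 (norm_le_zero_iff.1 this)
  -- A point of [-1, 1] where f equals 1 is interior to the larger interval, on which f ≤ 1; it is a
  -- local maximum.
  have hmax : ∀ y ∈ Set.Icc (-1 : ℝ) 1, f y = 1 → deriv f y = 0 := by
    intro y hy hfy
    refine IsLocalMax.deriv_eq_zero ?_
    filter_upwards [isOpen_Ioo.mem_nhds (hsub hy)] with t ht
    rw [hfy]
    exact (hm (Set.Ioo_subset_Icc_self ht)).2
  obtain ⟨c, hc, hc'⟩ := exists_deriv_eq_slope f (show (-1 : ℝ) < 1 by norm_num)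
    (fun y hy => (hd y hy).continuousAt.continuousWithinAt)
    (fun y hy => (hd y (Set.Ioo_subset_Icc_self hy)).differentiableWithinAt)
  rw [hconst c (Set.Ioo_subset_Icc_self hc)] at hc'
  have hb1 := hm (Set.Ioo_subset_Icc_self (hsub h1m))
  have hb2 := hm (Set.Ioo_subset_Icc_self (hsub h2m))
  have e : f 1 - f (-1) = 2 * deriv f 1 := by
    rw [hc']; ring
  refine ⟨deriv f 1, ?_, hconst⟩
  rw [sq_lt_one_iff_abs_lt_one, abs_lt]
  constructor
  -- Slope at most −1 forces f(−1) = 1 and f(1) = −1, as the image lies in [-1, 1]; then the slope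
  -- vanishes at −1, a contradiction. Slope at least 1 is excluded in the same way at 1.
  · by_contra! h
    have h1 : f (-1) = 1 := le_antisymm hb2.2 (by linarith [hb1.1])
    have := hmax _ h2m h1
    rw [hconst _ h2m] at this
    linarith
  · by_contra! h
    have h1 : f 1 = 1 := le_antisymm hb1.2 (by linarith [hb2.1])
    have := hmax _ h1m h1
    linarith

/-- With constant slope l the sum obeys Λ_2(n+1) = l² Λ_2(n) + 1, a geometric series. -/
lemma lyapunov_two_le_of_deriv_eq (S : OneDimMap) {x : ℝ} (hx : x ∈ S.domain) {l : ℝ}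
    (hl : l ^ 2 < 1) (h : ∀ y ∈ S.domain, deriv S.toFun y = l) (n : ℕ) :
    S.lyapunov 2 x n ≤ (1 - l ^ 2)⁻¹ := by
  have hpos : 0 < 1 - l ^ 2 := by linarith
  unfold lyapunov
  induction n with
  | zero => simpa using hpos.le
  | succ n ih =>
    rw [Finset.sum_Icc_succ_top (by omega), deriv_iterate_self]
    have e : ∑ j ∈ Finset.Icc 1 n, |deriv (S.toFun^[n + 1 - j]) (S.toFun^[j] x)| ^ (2 : ℝ)
        = l ^ 2 * ∑ j ∈ Finset.Icc 1 n, |deriv (S.toFun^[n - j]) (S.toFun^[j] x)| ^ (2 : ℝ) := by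
      rw [Finset.mul_sum]
      refine Finset.sum_congr rfl fun j hj => ?_
      rw [deriv_iterate_succ (S.differentiableAt_orbit hx) (Finset.mem_Icc.1 hj).2,
        h _ (S.iterate_mem_domain hx n)]
      simp only [Real.rpow_two, sq_abs, mul_pow]
    rw [e]
    have h1 := mul_le_mul_of_nonneg_left ih (sq_nonneg l)
    have h2 : (1 - l ^ 2) * (1 - l ^ 2)⁻¹ = 1 := mul_inv_cancel₀ hpos.ne'
    simp only [abs_one, Real.one_rpow]
    linarith

/-- Either the map is a uniform contraction along the orbit, or the noisy orbits satisfy a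
second-order Taylor estimate with a constant controlled by `‖f''‖`. -/
lemma bounded_lyapunov_or_taylor (S : OneDimMap) {x : ℝ} (hx : x ∈ S.domain)
    (hL : S.secondDerivNorm ≠ ⊤) :
    (∃ M : ℝ, ∀ n, S.lyapunov 2 x n ≤ M) ∨
    ∃ K κ : ℝ, 0 ≤ K ∧ 0 ≤ κ ∧ K ≤ κ * S.secondDerivNorm.toReal ∧
      ∀ (ξ : ℕ → Ω → ℝ) (σ : ℝ) (n : ℕ) (ω : Ω), 0 < σ →
        (κ * S.secondDerivNorm.toReal * σ * maxNoise ξ n ω ≤ 1 → ω ∈ S.staysInside ξ σ n) ∧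
        (ω ∈ S.staysInside ξ σ n → ∀ m < n,
          |S.toFun (S.noisyOrbit ξ x σ m ω) - S.toFun (S.toFun^[m] x)
              - deriv S.toFun (S.toFun^[m] x) * (S.noisyOrbit ξ x σ m ω - S.toFun^[m] x)|
            ≤ K * (S.noisyOrbit ξ x σ m ω - S.toFun^[m] x) ^ 2) := by
  have hL' : ∀ y ∈ S.domain, |deriv (deriv S.toFun) y| ≤ S.secondDerivNorm.toReal :=
    fun y hy => S.abs_deriv_deriv_le hL hy
  generalize S.secondDerivNorm.toReal = L at hL'
  cases S with
  | line f hf =>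
    have hK : ∀ y, |deriv (deriv f) y| ≤ L := fun y => hL' y trivial
    exact Or.inr ⟨L, 1, (abs_nonneg _).trans (hK 0), zero_le_one, by rw [one_mul],
      fun ξ σ n ω _ => ⟨fun _ => trivial, fun _ m _ => taylor_of_contDiff hf hK _ _⟩⟩
  | circle f F hF hl =>
    have hK : ∀ y, |deriv (deriv F) y| ≤ L := fun y => hL' y trivial
    exact Or.inr ⟨L, 1, (abs_nonneg _).trans (hK 0), zero_le_one, by rw [one_mul],
      fun ξ σ n ω _ => ⟨fun _ => trivial, fun _ m _ => taylor_of_contDiff hF hK _ _⟩⟩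
  | interval a ha f hf hm =>
    have hL0 : 0 ≤ L := (abs_nonneg _).trans (hL' x hx)
    rcases hL0.eq_or_lt with h | hLpos
    · left
      obtain ⟨l, hl, hl'⟩ := exists_slope_of_deriv_deriv_eq_zero ha hf hm fun y hy =>
        abs_eq_zero.1 (le_antisymm ((hL' y hy).trans h.symm.le) (abs_nonneg _))
      exact ⟨_, fun n => lyapunov_two_le_of_deriv_eq _ hx hl hl' n⟩
    · right
      obtain ⟨K, hK0, hK⟩ := exists_taylor_of_contDiffOn ha hf
      -- The entry K/L makes the Taylor constant a multiple of ‖f''‖; the entry 1/(aL) makes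
      -- smallness of ‖f''‖ση imply ση ≤ a.
      refine ⟨K, max (K / L) (1 / (a * L)), hK0, (by positivity : 0 ≤ K / L).trans
        (le_max_left _ _), ?_, fun ξ σ n ω hσ => ⟨fun h => ?_, fun h m hmn => ?_⟩⟩
      · have := mul_le_mul_of_nonneg_right (le_max_left (K / L) (1 / (a * L))) hLpos.le
        rwa [div_mul_cancel₀ _ hLpos.ne'] at this
      · have hη := maxNoise_nonneg ξ n ω
        have h1 : 1 / (a * L) * L * (σ * maxNoise ξ n ω) ≤ 1 := by
          refine le_trans ?_ h
          rw [mul_assoc (max (K / L) (1 / (a * L)) * L)]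
          exact mul_le_mul_of_nonneg_right (mul_le_mul_of_nonneg_right (le_max_right _ _) hLpos.le)
            (by positivity)
        have e : 1 / (a * L) * L * (σ * maxNoise ξ n ω) = σ * maxNoise ξ n ω / a := by
          field_simp
        rw [e, div_le_one ha] at h1
        exact h1
      · refine hK _ ?_ _ (iterate_mem_domain _ hx m)
        cases m with
        | zero => exact ⟨by have := hx.1; change -1 - a ≤ x; linarith,
            by have := hx.2; change x ≤ 1 + a; linarith⟩
        | succ m =>
          have hin : ∀ k < n, (interval a ha f hf hm).noisyOrbit ξ x σ k ω
              ∈ Set.Icc (-1 - a) (1 + a) := by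
            intro k
            induction k with
            | zero => exact fun _ => ⟨by have := hx.1; change -1 - a ≤ x; linarith,
                by have := hx.2; change x ≤ 1 + a; linarith⟩
            | succ k ih =>
              intro hk
              have h1 := hm (ih (by omega))
              have h2 : σ * |ξ (k + 1) ω| ≤ a :=
                (mul_le_mul_of_nonneg_left (abs_le_maxNoise ξ
                  (Finset.mem_Icc.2 ⟨by omega, by omega⟩) ω) hσ.le).trans h
              have h3 : |σ * ξ (k + 1) ω| ≤ a := by rwa [abs_mul, abs_of_pos hσ]
              rw [abs_le] at h3
              constructor
              · change _ ≤ f _ + σ * ξ (k + 1) ω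
                linarith [h1.1]
              · change f _ + σ * ξ (k + 1) ω ≤ _
                linarith [h1.2]
          exact hin _ hmn

lemma sum_le_lyapunovHat (S : OneDimMap) (x : ℝ) {m n : ℕ} (h : m ≤ n) :
    ∑ j ∈ Finset.range (m + 1), |deriv (S.toFun^[m - j]) (S.toFun^[j] x)| ≤ S.lyapunovHat x n :=
  Finset.le_sup' (f := fun i =>
    ∑ j ∈ Finset.range (i + 1), |deriv (S.toFun^[i - j]) (S.toFun^[j] x)|)
    (Finset.mem_range.2 (Nat.lt_succ_of_le h))

lemma sum_Icc_le_lyapunovHat (S : OneDimMap) (x : ℝ) {m n : ℕ} (h : m ≤ n) :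
    ∑ j ∈ Finset.Icc 1 m, |deriv (S.toFun^[m - j]) (S.toFun^[j] x)| ≤ S.lyapunovHat x n :=
  (Finset.sum_le_sum_of_subset_of_nonneg (fun j hj => by
    have := (Finset.mem_Icc.1 hj).2
    exact Finset.mem_range.2 (by omega)) fun _ _ _ => abs_nonneg _).trans
    (S.sum_le_lyapunovHat x h)

lemma one_le_lyapunovHat (S : OneDimMap) (x : ℝ) (n : ℕ) : 1 ≤ S.lyapunovHat x n := by
  have := S.sum_le_lyapunovHat x (Nat.zero_le n)
  simpa using this

/-- The deviation of the noisy orbit from its linearization. -/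
lemma abs_noisyOrbit_sub_le (S : OneDimMap) {x : ℝ} (hx : x ∈ S.domain) {ξ : ℕ → Ω → ℝ} {σ K : ℝ}
    {n : ℕ} {ω : Ω} (hσ : 0 ≤ σ) (hK : 0 ≤ K)
    (hT : ∀ m < n,
      |S.toFun (S.noisyOrbit ξ x σ m ω) - S.toFun (S.toFun^[m] x)
          - deriv S.toFun (S.toFun^[m] x) * (S.noisyOrbit ξ x σ m ω - S.toFun^[m] x)|
        ≤ K * (S.noisyOrbit ξ x σ m ω - S.toFun^[m] x) ^ 2)
    (hsmall : 4 * K * σ * S.lyapunovHat x n ^ 2 * maxNoise ξ n ω ≤ 1) :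
    |S.noisyOrbit ξ x σ n ω - S.toFun^[n] x - σ * S.linearNoise ξ x n ω|
      ≤ 4 * K * σ ^ 2 * S.lyapunovHat x n ^ 3 * maxNoise ξ n ω ^ 2 :=
  abs_deviation_sub_le (F := S.toFun) (X := fun m => S.noisyOrbit ξ x σ m ω) (ξ := fun j => ξ j ω)
    (S.differentiableAt_orbit hx) rfl (fun _ => rfl) hσ (maxNoise_nonneg _ _ _)
    (zero_le_one.trans (S.one_le_lyapunovHat x n)) hK
    (fun _ hm => S.sum_Icc_le_lyapunovHat x hm) (fun _ hj => abs_le_maxNoise ξ hj ω) hT hsmall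

end OneDimMap

/-! ### Moments of the noise -/

section Moments

variable {Ω : Type*} [MeasurableSpace Ω] {P : Measure Ω}

lemma momentNorm_two (X : Ω → ℝ) : momentNorm P 2 X = √(∫ ω, X ω ^ 2 ∂P) := by
  unfold momentNorm
  rw [Real.sqrt_eq_rpow]
  simp only [Real.rpow_two, sq_abs]

lemma integral_rpow_eq_momentNorm_rpow {s : ℝ} (hs : 0 < s) (X : Ω → ℝ) :
    ∫ ω, |X ω| ^ s ∂P = momentNorm P s X ^ s := by
  have h : 0 ≤ ∫ ω, |X ω| ^ s ∂P := integral_nonneg fun ω => Real.rpow_nonneg (abs_nonneg _) _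
  unfold momentNorm
  rw [← Real.rpow_mul h, one_div_mul_cancel hs.ne', Real.rpow_one]

lemma momentNorm_nonneg (s : ℝ) (X : Ω → ℝ) : 0 ≤ momentNorm P s X :=
  Real.rpow_nonneg (integral_nonneg fun _ => Real.rpow_nonneg (abs_nonneg _) _) _

lemma integrable_abs_rpow {s : ℝ} (hs : 0 < s) {X : Ω → ℝ} (hX : MemLp X (ENNReal.ofReal s) P) :
    Integrable (fun ω => |X ω| ^ s) P := by
  have := hX.integrable_norm_rpow (by simpa using hs) ENNReal.ofReal_ne_top
  rwa [ENNReal.toReal_ofReal hs.le] at this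

lemma measurable_maxNoise {ξ : ℕ → Ω → ℝ} (hm : ∀ n, Measurable (ξ n)) (n : ℕ) :
    Measurable (maxNoise ξ n) := by
  have h : ∀ T : Finset ℕ, Measurable fun ω => T.sup fun j => ‖ξ j ω‖₊ := fun T => by
    induction T using Finset.induction_on with
    | empty => simp
    | insert j T _ ih => simpa only [Finset.sup_insert] using (hm j).nnnorm.max ih
  exact measurable_coe_nnreal_real.comp (h _)

lemma memLp_maxNoise {ξ : ℕ → Ω → ℝ} (hm : ∀ n, Measurable (ξ n)) {q : ℝ≥0∞}
    (h : ∀ n, MemLp (ξ n) q P) (n : ℕ) : MemLp (maxNoise ξ n) q P := by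
  have hsum : MemLp (fun ω => ∑ j ∈ Finset.Icc 1 n, |ξ j ω|) q P :=
    memLp_finsetSum _ fun j _ => (h j).norm
  refine hsum.mono (measurable_maxNoise hm n).aestronglyMeasurable
    (Eventually.of_forall fun ω => ?_)
  rw [Real.norm_of_nonneg (OneDimMap.maxNoise_nonneg ξ n ω),
    Real.norm_of_nonneg (Finset.sum_nonneg fun j _ => abs_nonneg _)]
  have h1 : ((Finset.Icc 1 n).sup fun j => ‖ξ j ω‖₊) ≤ ∑ j ∈ Finset.Icc 1 n, ‖ξ j ω‖₊ :=
    Finset.sup_le fun j hj => Finset.single_le_sum (f := fun j => ‖ξ j ω‖₊)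
      (fun _ _ => zero_le) hj
  have h2 := NNReal.coe_le_coe.2 h1
  rw [NNReal.coe_sum] at h2
  exact h2

variable [IsProbabilityMeasure P]

/-- Jensen's inequality for t ↦ t^{s/2} applied to X². -/
lemma integral_sq_le_momentNorm_sq {s : ℝ} (hs : 2 ≤ s) {X : Ω → ℝ}
    (hX : MemLp X (ENNReal.ofReal s) P) : ∫ ω, X ω ^ 2 ∂P ≤ momentNorm P s X ^ 2 := by
  have hs0 : 0 < s := by linarith
  have hX2 : MemLp X 2 P := hX.mono_exponent (by
    rw [← ENNReal.ofReal_ofNat]; exact ENNReal.ofReal_le_ofReal hs)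
  have hpow : ∀ y : ℝ, (y ^ 2) ^ (s / 2) = |y| ^ s := fun y => by
    rw [← sq_abs, ← Real.rpow_natCast, ← Real.rpow_mul (abs_nonneg _)]
    congr 1
    push_cast
    ring
  have h := (convexOn_rpow (p := s / 2) (by linarith)).map_integral_le (μ := P)
    (f := fun ω => X ω ^ 2)
    (Real.continuous_rpow_const (by linarith)).continuousOn isClosed_Ici
    (Eventually.of_forall fun ω => sq_nonneg (X ω)) hX2.integrable_sq (by
      refine (integrable_abs_rpow hs0 hX).congr (Eventually.of_forall fun ω => ?_)
      exact (hpow _).symm)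
  simp only [hpow] at h
  rw [integral_rpow_eq_momentNorm_rpow hs0] at h
  have e : momentNorm P s X ^ s = (momentNorm P s X ^ 2) ^ (s / 2) := by
    rw [hpow, abs_of_nonneg (momentNorm_nonneg _ _)]
  rw [e] at h
  exact (Real.rpow_le_rpow_iff (integral_nonneg fun ω => sq_nonneg _) (sq_nonneg _)
    (by linarith)).1 h

lemma IsNoise.exists_moment_bounds {ξ : ℕ → Ω → ℝ} {p s : ℝ} (hξ : IsNoise P ξ p) (hs : 2 < s)
    (hsp : s ≤ p) : ∃ c C D : ℝ, 0 < c ∧ 0 < C ∧ 0 < D ∧ ∀ n,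
      MemLp (ξ n) (ENNReal.ofReal s) P ∧ MemLp (ξ n) 2 P ∧ c ^ 2 ≤ ∫ ω, ξ n ω ^ 2 ∂P ∧
      ∫ ω, ξ n ω ^ 2 ∂P ≤ C ^ 2 ∧ ∫ ω, |ξ n ω| ^ s ∂P ≤ D := by
  obtain ⟨c, C, hc, h⟩ := hξ.moments
  have hC : 0 < C := hc.trans_le ((h 0).1.trans ((h 0).2.1.trans (h 0).2.2))
  have hCp : 0 < C ^ p := Real.rpow_pos_of_pos hC p
  refine ⟨c, C, 1 + C ^ p, hc, hC, by linarith, fun n => ?_⟩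
  obtain ⟨h1, h2, h3⟩ := h n
  have hI : 0 ≤ ∫ ω, ξ n ω ^ 2 ∂P := integral_nonneg fun ω => sq_nonneg _
  have hms : MemLp (ξ n) (ENNReal.ofReal s) P :=
    (hξ.memLp n).mono_exponent (ENNReal.ofReal_le_ofReal hsp)
  have hm2 : MemLp (ξ n) 2 P := hms.mono_exponent (by
    rw [← ENNReal.ofReal_ofNat]; exact ENNReal.ofReal_le_ofReal hs.le)
  refine ⟨hms, hm2, ?_, ?_, ?_⟩
  · rw [momentNorm_two] at h1
    rw [← Real.sq_sqrt hI]
    exact pow_le_pow_left₀ hc.le h1 2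
  · have h4 := h2.trans h3
    rw [momentNorm_two] at h4
    rw [← Real.sq_sqrt hI]
    exact pow_le_pow_left₀ (Real.sqrt_nonneg _) h4 2
  · have hp0 : 0 < p := by linarith
    have h5 : ∫ ω, |ξ n ω| ^ p ∂P ≤ C ^ p := by
      rw [integral_rpow_eq_momentNorm_rpow hp0]
      exact Real.rpow_le_rpow (momentNorm_nonneg _ _) h3 hp0.le
    have hip := integrable_abs_rpow hp0 (hξ.memLp n)
    have h6 : ∫ ω, |ξ n ω| ^ s ∂P ≤ ∫ ω, (1 + |ξ n ω| ^ p) ∂P := by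
      refine integral_mono (integrable_abs_rpow (by linarith) hms)
        ((integrable_const _).add hip) fun ω => ?_
      have h0 := Real.rpow_nonneg (abs_nonneg (ξ n ω)) p
      rcases le_total |ξ n ω| 1 with h | h
      · have := Real.rpow_le_one (abs_nonneg _) h (by linarith : 0 ≤ s)
        simp only
        linarith
      · have := Real.rpow_le_rpow_of_exponent_le h hsp
        simp only
        linarith
    rw [integral_add (integrable_const _) hip] at h6
    simp only [integral_const, probReal_univ, one_smul] at h6
    linarith

end Moments

/-! ### The Lyapunov functions -/

namespace OneDimMap

variable {Ω : Type*}

lemma lyapunov_term_le (S : OneDimMap) (s x : ℝ) {n j : ℕ} (hj : j ∈ Finset.Icc 1 n) :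
    |deriv (S.toFun^[n - j]) (S.toFun^[j] x)| ^ s ≤ S.lyapunov s x n :=
  Finset.single_le_sum (f := fun j => |deriv (S.toFun^[n - j]) (S.toFun^[j] x)| ^ s)
    (fun _ _ => Real.rpow_nonneg (abs_nonneg _) _) hj

lemma one_le_lyapunov (S : OneDimMap) (s x : ℝ) {n : ℕ} (hn : 0 < n) : 1 ≤ S.lyapunov s x n := by
  have := S.lyapunov_term_le s x (Finset.mem_Icc.2 ⟨hn, le_rfl⟩)
  simpa using this

lemma lyapunov_two_eq (S : OneDimMap) (x : ℝ) (n : ℕ) :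
    S.lyapunov 2 x n = ∑ j ∈ Finset.Icc 1 n, deriv (S.toFun^[n - j]) (S.toFun^[j] x) ^ 2 := by
  simp only [lyapunov, Real.rpow_two, sq_abs]

lemma lyapunov_two_le_lyapunovHat_sq (S : OneDimMap) (x : ℝ) (n : ℕ) :
    S.lyapunov 2 x n ≤ S.lyapunovHat x n ^ 2 := by
  have h := S.sum_Icc_le_lyapunovHat x (le_refl n)
  have h0 : ∀ j ∈ Finset.Icc 1 n, 0 ≤ |deriv (S.toFun^[n - j]) (S.toFun^[j] x)| :=
    fun _ _ => abs_nonneg _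
  refine le_trans ?_ (pow_le_pow_left₀ (Finset.sum_nonneg h0) h 2)
  simp only [lyapunov, Real.rpow_two]
  exact Finset.sum_sq_le_sq_sum_of_nonneg h0

lemma lyapunovRatio_pos (S : OneDimMap) (s x : ℝ) {n : ℕ} (hn : 0 < n) :
    0 < S.lyapunovRatio s x n :=
  div_pos (zero_lt_one.trans_le (S.one_le_lyapunov s x hn))
    (Real.rpow_pos_of_pos (zero_lt_one.trans_le (S.one_le_lyapunov 2 x hn)) _)

/-- `Λ_s / Λ_2^{s/2}` is the sum of the powers of the normalized coefficients. -/
lemma lyapunovRatio_eq_sum (S : OneDimMap) (s x : ℝ) (n : ℕ) :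
    S.lyapunovRatio s x n = ∑ j ∈ Finset.Icc 1 n,
      (|deriv (S.toFun^[n - j]) (S.toFun^[j] x)| / √(S.lyapunov 2 x n)) ^ s := by
  have h0 : 0 ≤ S.lyapunov 2 x n :=
    Finset.sum_nonneg fun _ _ => Real.rpow_nonneg (abs_nonneg _) _
  unfold lyapunovRatio
  conv_lhs => rw [lyapunov, Finset.sum_div]
  refine Finset.sum_congr rfl fun j _ => ?_
  rw [Real.div_rpow (abs_nonneg _) (Real.sqrt_nonneg _), Real.sqrt_eq_rpow,
    ← Real.rpow_mul h0]
  congr 2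
  ring

/-- The squares of the normalized coefficients b_j sum to one. For s ≥ 3, b^s ≤ b³ ≤ δ b²; for s ≥ 2
and δ = 1, b^s ≤ b². -/
lemma lyapunovRatio_le_of_le (S : OneDimMap) (x : ℝ) {s δ : ℝ} (hs : 3 ≤ s ∨ (2 ≤ s ∧ δ = 1))
    {n : ℕ} (hn : 0 < n)
    (hδ : ∀ j ∈ Finset.Icc 1 n,
      |deriv (S.toFun^[n - j]) (S.toFun^[j] x)| / √(S.lyapunov 2 x n) ≤ δ) (hδ1 : δ ≤ 1) :
    S.lyapunovRatio s x n ≤ δ := by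
  have hpos : 0 < S.lyapunov 2 x n := zero_lt_one.trans_le (S.one_le_lyapunov 2 x hn)
  have hb0 : ∀ j, 0 ≤ |deriv (S.toFun^[n - j]) (S.toFun^[j] x)| / √(S.lyapunov 2 x n) :=
    fun j => div_nonneg (abs_nonneg _) (Real.sqrt_nonneg _)
  have hδ0 : 0 ≤ δ := (hb0 n).trans (hδ n (Finset.mem_Icc.2 ⟨hn, le_rfl⟩))
  have hsq : ∑ j ∈ Finset.Icc 1 n,
      (|deriv (S.toFun^[n - j]) (S.toFun^[j] x)| / √(S.lyapunov 2 x n)) ^ 2 = 1 := by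
    simp only [div_pow, sq_abs, Real.sq_sqrt hpos.le]
    rw [← Finset.sum_div, ← lyapunov_two_eq, div_self hpos.ne']
  rw [lyapunovRatio_eq_sum]
  calc _ ≤ ∑ j ∈ Finset.Icc 1 n,
        δ * (|deriv (S.toFun^[n - j]) (S.toFun^[j] x)| / √(S.lyapunov 2 x n)) ^ 2 := by
        refine Finset.sum_le_sum fun j hj => ?_
        have h1 := (hδ j hj).trans hδ1
        rcases hs with hs | ⟨hs, rfl⟩
        · have h2 := Real.rpow_le_rpow_of_exponent_ge' (hb0 j) h1 (by norm_num : (0 : ℝ) ≤ 3) hs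
          refine h2.trans ?_
          have e : (3 : ℝ) = ((3 : ℕ) : ℝ) := by norm_num
          rw [e, Real.rpow_natCast, pow_succ']
          exact mul_le_mul_of_nonneg_right (hδ j hj) (sq_nonneg _)
        · have h2 := Real.rpow_le_rpow_of_exponent_ge' (hb0 j) h1 (by norm_num : (0 : ℝ) ≤ 2) hs
          rwa [Real.rpow_two, ← one_mul (_ ^ 2)] at h2
    _ = δ := by rw [← Finset.mul_sum, hsq, mul_one]

lemma normalized_coeff_le_one (S : OneDimMap) (x : ℝ) {n j : ℕ} (hj : j ∈ Finset.Icc 1 n) :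
    |deriv (S.toFun^[n - j]) (S.toFun^[j] x)| / √(S.lyapunov 2 x n) ≤ 1 := by
  refine div_le_one_of_le₀ (Real.le_sqrt_of_sq_le ?_) (Real.sqrt_nonneg _)
  have := S.lyapunov_term_le 2 x hj
  rwa [Real.rpow_two] at this

lemma lyapunovRatio_le_one (S : OneDimMap) (x : ℝ) {s : ℝ} (hs : 2 ≤ s) {n : ℕ} (hn : 0 < n) :
    S.lyapunovRatio s x n ≤ 1 :=
  S.lyapunovRatio_le_of_le x (Or.inr ⟨hs, rfl⟩) hn (fun _ hj => S.normalized_coeff_le_one x hj)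
    le_rfl

/-- Every normalized coefficient is at most the p-th root of the ratio of order p. This transfers
the limit hypothesis from the exponent p to s = 3 when p > 3. -/
lemma lyapunovRatio_three_le (S : OneDimMap) (x : ℝ) {p : ℝ} (hp : 2 ≤ p) {n : ℕ} (hn : 0 < n) :
    S.lyapunovRatio 3 x n ≤ S.lyapunovRatio p x n ^ (1 / p) := by
  have hp0 : 0 < p := by linarith
  have h0 := (S.lyapunovRatio_pos p x hn).le
  refine S.lyapunovRatio_le_of_le x (Or.inl le_rfl) hn (fun j hj => ?_)
    (Real.rpow_le_one h0 (S.lyapunovRatio_le_one x hp hn) (by positivity))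
  have hb0 : 0 ≤ |deriv (S.toFun^[n - j]) (S.toFun^[j] x)| / √(S.lyapunov 2 x n) :=
    div_nonneg (abs_nonneg _) (Real.sqrt_nonneg _)
  have h1 : (|deriv (S.toFun^[n - j]) (S.toFun^[j] x)| / √(S.lyapunov 2 x n)) ^ p
      ≤ S.lyapunovRatio p x n := by
    rw [lyapunovRatio_eq_sum]
    exact Finset.single_le_sum
      (f := fun j => (|deriv (S.toFun^[n - j]) (S.toFun^[j] x)| / √(S.lyapunov 2 x n)) ^ p)
      (fun _ _ => Real.rpow_nonneg (div_nonneg (abs_nonneg _) (Real.sqrt_nonneg _)) _) hj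
  have h2 := Real.rpow_le_rpow (Real.rpow_nonneg hb0 _) h1 (by positivity : 0 ≤ 1 / p)
  rwa [← Real.rpow_mul hb0, mul_one_div_cancel hp0.ne', Real.rpow_one] at h2

lemma tendsto_lyapunovRatio_min (S : OneDimMap) (x : ℝ) {p : ℝ} (hp : 2 < p) {n : ℕ → ℕ}
    (hn : ∀ k, 0 < n k) (h : Tendsto (fun k => S.lyapunovRatio p x (n k)) atTop (𝓝 0)) :
    Tendsto (fun k => S.lyapunovRatio (min p 3) x (n k)) atTop (𝓝 0) := by
  rcases le_total p 3 with h3 | h3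
  · rwa [min_eq_left h3]
  · rw [min_eq_right h3]
    refine squeeze_zero (fun k => (S.lyapunovRatio_pos 3 x (hn k)).le)
      (fun k => S.lyapunovRatio_three_le x hp.le (hn k)) ?_
    have hp0 : 0 < 1 / p := by positivity
    have := h.rpow_const (p := 1 / p) (Or.inr hp0.le)
    rwa [Real.zero_rpow hp0.ne'] at this

lemma not_tendsto_lyapunovRatio_of_bounded (S : OneDimMap) (x : ℝ) {p M : ℝ} (hp : 0 < p)
    (hM : ∀ n, S.lyapunov 2 x n ≤ M) {n : ℕ → ℕ} (hn : ∀ k, 0 < n k) :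
    ¬ Tendsto (fun k => S.lyapunovRatio p x (n k)) atTop (𝓝 0) := by
  intro h
  have hM1 : 1 ≤ M := (S.one_le_lyapunov 2 x (hn 0)).trans (hM _)
  have hMp : 0 < M ^ (p / 2) := Real.rpow_pos_of_pos (by linarith) _
  have hle : 1 / M ^ (p / 2) ≤ 0 := by
    refine ge_of_tendsto h (Eventually.of_forall fun k => ?_)
    have h1 := S.one_le_lyapunov 2 x (hn k)
    exact div_le_div₀ (by linarith [S.one_le_lyapunov p x (hn k)]) (S.one_le_lyapunov p x (hn k))
      (Real.rpow_pos_of_pos (by linarith) _)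
      (Real.rpow_le_rpow (by linarith) (hM _) (by positivity))
  have : 0 < 1 / M ^ (p / 2) := by positivity
  linarith

/-! ### The linearized noise -/

variable [MeasurableSpace Ω] {P : Measure Ω}

lemma variance_linearNoise (S : OneDimMap) {ξ : ℕ → Ω → ℝ} (hi : iIndepFun ξ P)
    (h2 : ∀ n, MemLp (ξ n) 2 P) (h0 : ∀ n, ∫ ω, ξ n ω ∂P = 0) (x : ℝ) (n : ℕ) :
    Var[S.linearNoise ξ x n; P] = ∑ j ∈ Finset.Icc 1 n,
      deriv (S.toFun^[n - j]) (S.toFun^[j] x) ^ 2 * ∫ ω, ξ j ω ^ 2 ∂P := by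
  have hi' : iIndepFun (fun j ω => deriv (S.toFun^[n - j]) (S.toFun^[j] x) * ξ j ω) P :=
    hi.comp (fun j y => deriv (S.toFun^[n - j]) (S.toFun^[j] x) * y) fun _ => by fun_prop
  have h := BerryEsseen.variance_sum_eq (T := Finset.Icc 1 n) hi' fun j _ => (h2 j).const_mul _
  refine h.trans (Finset.sum_congr rfl fun j _ => ?_)
  rw [variance_const_mul, variance_of_integral_eq_zero (h2 j).aemeasurable (h0 j)]

/-- The left side is the smaller of y² and |y|³, hence lies below every intermediate power. -/
lemma sq_mul_min_le_rpow {s : ℝ} (hs2 : 2 ≤ s) (hs3 : s ≤ 3) (y : ℝ) :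
    y ^ 2 * min 1 |y| ≤ |y| ^ s := by
  rcases le_total 1 |y| with h | h
  · rw [min_eq_left h, mul_one, ← sq_abs, ← Real.rpow_two]
    exact Real.rpow_le_rpow_of_exponent_le h hs2
  · rw [min_eq_right h, ← sq_abs, ← pow_succ]
    have := Real.rpow_le_rpow_of_exponent_ge' (abs_nonneg y) h (by linarith) hs3
    refine le_trans (le_of_eq ?_) this
    rw [← Real.rpow_natCast]
    norm_num

/-- The Berry–Esseen estimate for the normalized linearized noise. -/
lemma abs_cdf_linearNoise_sub_le [IsProbabilityMeasure P] (S : OneDimMap) {ξ : ℕ → Ω → ℝ} (hm : ∀ n, Measurable (ξ n))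
    (hi : iIndepFun ξ P) (h0 : ∀ n, ∫ ω, ξ n ω ∂P = 0) {s c D : ℝ} (hs2 : 2 ≤ s) (hs3 : s ≤ 3)
    (hc : 0 < c) (hD : 0 < D) (h2 : ∀ n, MemLp (ξ n) 2 P)
    (hs : ∀ n, MemLp (ξ n) (ENNReal.ofReal s) P)
    (hD' : ∀ n, ∫ ω, |ξ n ω| ^ s ∂P ≤ D) (x : ℝ) {n : ℕ} (hn : 0 < n)
    (hV : c ^ 2 * S.lyapunov 2 x n ≤ Var[S.linearNoise ξ x n; P]) (z : ℝ) :
    |P.real {ω | S.linearNoise ξ x n ω / √(Var[S.linearNoise ξ x n; P]) ≤ z}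
        - cdf (gaussianReal 0 1) z| ≤ 200 * (D / c ^ s * S.lyapunovRatio s x n) := by
  set V := Var[S.linearNoise ξ x n; P] with hVdef
  have hs0 : 0 < s := by linarith
  have hΛ : 1 ≤ S.lyapunov 2 x n := S.one_le_lyapunov 2 x hn
  have hΛs : 0 < √(S.lyapunov 2 x n) := Real.sqrt_pos.2 (by linarith)
  have hV0 : 0 < V := lt_of_lt_of_le (by positivity) hV
  have hsV : 0 < √V := Real.sqrt_pos.2 hV0
  have hsV' : c * √(S.lyapunov 2 x n) ≤ √V := by
    refine Real.le_sqrt_of_sq_le ?_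
    rwa [mul_pow, Real.sq_sqrt (by linarith)]
  set a : ℕ → ℝ := fun j => deriv (S.toFun^[n - j]) (S.toFun^[j] x) with ha
  set X : ℕ → Ω → ℝ := fun j ω => a j / √V * ξ j ω with hX
  have hX2 : ∀ j, MemLp (X j) 2 P := fun j => (h2 j).const_mul _
  have hsum : ∀ ω, ∑ j ∈ Finset.Icc 1 n, X j ω = S.linearNoise ξ x n ω / √V := fun ω => by
    simp only [hX, linearNoise, Finset.sum_div, ha]
    exact Finset.sum_congr rfl fun j _ => by ring
  have hvar : ∑ j ∈ Finset.Icc 1 n, ∫ ω, X j ω ^ 2 ∂P = 1 := by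
    have h : ∀ j, ∫ ω, X j ω ^ 2 ∂P = a j ^ 2 * (∫ ω, ξ j ω ^ 2 ∂P) / V := fun j => by
      simp only [hX, mul_pow, div_pow, Real.sq_sqrt hV0.le]
      rw [integral_const_mul]
      ring
    simp only [h]
    rw [← Finset.sum_div, div_eq_one_iff_eq hV0.ne']
    exact (S.variance_linearNoise hi h2 h0 x n).symm
  have hterm : ∀ j ∈ Finset.Icc 1 n, ∫ ω, X j ω ^ 2 * min 1 |X j ω| ∂P
      ≤ D / c ^ s * (|a j| / √(S.lyapunov 2 x n)) ^ s := by
    intro j _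
    have e : ∀ ω, |X j ω| ^ s = (|a j| / √V) ^ s * |ξ j ω| ^ s := fun ω => by
      simp only [hX]
      rw [abs_mul, abs_div, abs_of_pos hsV, Real.mul_rpow (by positivity) (abs_nonneg _)]
    have h1 : ∫ ω, X j ω ^ 2 * min 1 |X j ω| ∂P ≤ ∫ ω, |X j ω| ^ s ∂P := by
      refine integral_mono
        (BerryEsseen.integrable_sq_mul_min ((hm j).const_mul _) (hX2 j)) ?_
        fun ω => sq_mul_min_le_rpow hs2 hs3 _
      simp only [e]
      exact (integrable_abs_rpow hs0 (hs j)).const_mul _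
    simp only [e] at h1
    rw [integral_const_mul] at h1
    have h3 : (|a j| / √V) ^ s ≤ (|a j| / √(S.lyapunov 2 x n)) ^ s / c ^ s := by
      rw [← Real.div_rpow (by positivity) hc.le]
      refine Real.rpow_le_rpow (by positivity) ?_ hs0.le
      rw [div_div]
      exact div_le_div_of_nonneg_left (abs_nonneg _) (by positivity) (by linarith)
    refine h1.trans ((mul_le_mul h3 (hD' j) (integral_nonneg fun ω =>
      Real.rpow_nonneg (abs_nonneg _) _) (by positivity)).trans (le_of_eq (by ring)))
  have hB : ∑ j ∈ Finset.Icc 1 n, ∫ ω, X j ω ^ 2 * min 1 |X j ω| ∂P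
      ≤ D / c ^ s * S.lyapunovRatio s x n := by
    rw [lyapunovRatio_eq_sum, Finset.mul_sum]
    exact Finset.sum_le_sum hterm
  have h := BerryEsseen.berry_esseen (P := P) (X := X) (T := Finset.Icc 1 n)
    (fun j => (hm j).const_mul _) (hi.comp (fun j y => a j / √V * y) fun _ => by fun_prop)
    (fun j _ => hX2 j) (fun j _ => by
      simp only [hX]; rw [integral_const_mul, h0, mul_zero]) hvar
    (mul_pos (by positivity) (S.lyapunovRatio_pos s x hn)) hB z
  simp only [hsum] at h
  exact h

end OneDimMap

/-! ### The good event and the estimate at a fixed time -/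

namespace OneDimMap

variable {Ω : Type*} [MeasurableSpace Ω] {P : Measure Ω}

lemma measurableSet_goodEvent (S : OneDimMap) {ξ : ℕ → Ω → ℝ} (hm : ∀ n, Measurable (ξ n))
    (x σ : ℝ) (n : ℕ) : MeasurableSet (S.goodEvent ξ x σ n) := by
  have hη := measurable_maxNoise hm n
  refine MeasurableSet.inter (measurableSet_le ?_ measurable_const) ?_
  · exact (ENNReal.measurable_ofReal.comp (hη.const_mul _)).const_mul _
  · cases S with
    | line f hf => exact MeasurableSet.univ
    | circle f F hF hl => exact MeasurableSet.univ
    | interval a ha f hf hmaps => exact measurableSet_le (hη.const_mul σ) measurable_const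

lemma sq_mul_lyapunov_le_variance (S : OneDimMap) {ξ : ℕ → Ω → ℝ} (hi : iIndepFun ξ P)
    (h2 : ∀ n, MemLp (ξ n) 2 P) (h0 : ∀ n, ∫ ω, ξ n ω ∂P = 0) {c : ℝ}
    (hc : ∀ n, c ^ 2 ≤ ∫ ω, ξ n ω ^ 2 ∂P) (x : ℝ) (n : ℕ) :
    c ^ 2 * S.lyapunov 2 x n ≤ Var[S.linearNoise ξ x n; P] := by
  rw [S.variance_linearNoise hi h2 h0, lyapunov_two_eq, mul_comm, Finset.sum_mul]
  exact Finset.sum_le_sum fun j _ => mul_le_mul_of_nonneg_left (hc j) (sq_nonneg _)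

lemma sq_le_integral_maxNoise_sq {ξ : ℕ → Ω → ℝ} (hm : ∀ n, Measurable (ξ n))
    (h2 : ∀ n, MemLp (ξ n) 2 P) {c : ℝ} (hc : ∀ n, c ^ 2 ≤ ∫ ω, ξ n ω ^ 2 ∂P) {n : ℕ}
    (hn : 0 < n) : c ^ 2 ≤ ∫ ω, maxNoise ξ n ω ^ 2 ∂P := by
  refine (hc n).trans (integral_mono (h2 n).integrable_sq
    (memLp_maxNoise hm h2 n).integrable_sq fun ω => ?_)
  have := pow_le_pow_left₀ (abs_nonneg _)
    (abs_le_maxNoise ξ (Finset.mem_Icc.2 ⟨hn, le_rfl⟩) ω) 2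
  rwa [sq_abs] at this

variable [IsProbabilityMeasure P]

lemma measureReal_one_lt_le {Y : Ω → ℝ} (hY : Integrable (fun ω => Y ω ^ 2) P) {q : ℝ}
    (hq : 0 ≤ q) : P.real {ω | 1 < q * Y ω ^ 2} ≤ q * ∫ ω, Y ω ^ 2 ∂P := by
  have h := mul_meas_ge_le_integral_of_nonneg (μ := P) (f := fun ω => q * Y ω ^ 2)
    (Eventually.of_forall fun ω => mul_nonneg hq (sq_nonneg _)) (hY.const_mul q) 1
  rw [one_mul, integral_const_mul] at h
  refine le_trans (measureReal_mono ?_) h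
  intro ω hω
  simp only [Set.mem_ofPred_eq] at hω ⊢
  exact hω.le

/-- A random variable that is close to another one outside a small exceptional set has nearly the
same distribution function. -/
lemma abs_measureReal_le_sub_le {U W : Ω → ℝ} {E : Set Ω} {r A z : ℝ} (hr : 0 ≤ r)
    (hUW : ∀ ω ∉ E, |U ω - W ω| ≤ r)
    (hW : ∀ z, |P.real {ω | W ω ≤ z} - cdf (gaussianReal 0 1) z| ≤ A) :
    |P.real {ω | U ω ≤ z} - cdf (gaussianReal 0 1) z| ≤ A + r + P.real E := by
  have h1 : P.real {ω | U ω ≤ z} ≤ P.real {ω | W ω ≤ z + r} + P.real E := by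
    refine (measureReal_mono ?_).trans (measureReal_union_le _ _)
    intro ω hω
    by_cases h : ω ∈ E
    · exact Or.inr h
    · left
      have := abs_le.1 (hUW ω h)
      simp only [Set.mem_ofPred_eq] at hω ⊢
      linarith
  have h2 : P.real {ω | W ω ≤ z - r} ≤ P.real {ω | U ω ≤ z} + P.real E := by
    refine (measureReal_mono ?_).trans (measureReal_union_le _ _)
    intro ω hω
    by_cases h : ω ∈ E
    · exact Or.inr h
    · left
      have := abs_le.1 (hUW ω h)
      simp only [Set.mem_ofPred_eq] at hω ⊢
      linarith
  have h3 := SteinGaussian.Phi_le_add (show z ≤ z + r by linarith)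
  have h4 := SteinGaussian.Phi_le_add (show z - r ≤ z by linarith)
  unfold SteinGaussian.Phi at h3 h4
  have h5 := abs_le.1 (hW (z + r))
  have h6 := abs_le.1 (hW (z - r))
  rw [abs_le]
  constructor <;> linarith

/-- Markov's inequality twice, with M = E Y². For the first set, M ≥ c² allows h²M ≤ (hM)²/c² ≤
R⁴/c²; for the second, hM/R ≤ R. -/
lemma measureReal_exceptional_le {Y : Ω → ℝ} (hY : Integrable (fun ω => Y ω ^ 2) P)
    {h κ q R C c : ℝ} (hh : 0 ≤ h) (hκ : 0 ≤ κ) (hq0 : 0 ≤ q) (hq : q ≤ 4 * κ * C * h)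
    (hc : 0 < c) (hR : 0 < R) (hR1 : R ≤ 1) (hM : c ^ 2 ≤ ∫ ω, Y ω ^ 2 ∂P)
    (hhM : h * ∫ ω, Y ω ^ 2 ∂P ≤ R ^ 2) :
    P.real ({ω | 1 < q ^ 2 * Y ω ^ 2} ∪ {ω | 1 < 4 * κ * h / R * Y ω ^ 2})
      ≤ (16 * κ ^ 2 * C ^ 2 / c ^ 2 + 4 * κ) * R := by
  set M := ∫ ω, Y ω ^ 2 ∂P
  have hM0 : 0 < M := (by positivity : 0 < c ^ 2).trans_le hM
  have h1 := measureReal_one_lt_le hY (sq_nonneg q)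
  have h2 := measureReal_one_lt_le hY (by positivity : 0 ≤ 4 * κ * h / R)
  have h3 : q ^ 2 * M ≤ 16 * κ ^ 2 * C ^ 2 / c ^ 2 * R := by
    have e1 : q ^ 2 ≤ (4 * κ * C * h) ^ 2 := pow_le_pow_left₀ hq0 hq 2
    have e2 : (h * M) ^ 2 ≤ (R ^ 2) ^ 2 := pow_le_pow_left₀ (by positivity) hhM 2
    have e3 : (R ^ 2) ^ 2 ≤ R := by
      rw [← pow_mul]
      exact pow_le_of_le_one hR.le hR1 (by norm_num)
    have e4 : h ^ 2 * M ≤ R / c ^ 2 := by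
      rw [le_div_iff₀ (by positivity)]
      have := mul_le_mul_of_nonneg_left hM (by positivity : 0 ≤ h ^ 2 * M)
      calc h ^ 2 * M * c ^ 2 ≤ h ^ 2 * M * M := this
        _ = (h * M) ^ 2 := by ring
        _ ≤ R := e2.trans e3
    calc q ^ 2 * M ≤ (4 * κ * C * h) ^ 2 * M := mul_le_mul_of_nonneg_right e1 hM0.le
      _ = 16 * κ ^ 2 * C ^ 2 * (h ^ 2 * M) := by ring
      _ ≤ 16 * κ ^ 2 * C ^ 2 * (R / c ^ 2) := mul_le_mul_of_nonneg_left e4 (by positivity)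
      _ = 16 * κ ^ 2 * C ^ 2 / c ^ 2 * R := by ring
  have h4 : 4 * κ * h / R * M ≤ 4 * κ * R := by
    calc 4 * κ * h / R * M = 4 * κ / R * (h * M) := by ring
      _ ≤ 4 * κ / R * R ^ 2 := mul_le_mul_of_nonneg_left hhM (by positivity)
      _ = 4 * κ * R := by field_simp
  refine (measureReal_union_le _ _).trans ?_
  linarith

/-- The estimate at a fixed time and noise level, with the constants made explicit. -/
lemma goodEvent_and_berry_esseen (S : OneDimMap) {x : ℝ} (hx : x ∈ S.domain) {ξ : ℕ → Ω → ℝ}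
    (hm : ∀ n, Measurable (ξ n)) (hi : iIndepFun ξ P) (h0 : ∀ n, ∫ ω, ξ n ω ∂P = 0)
    {s c C D : ℝ} (hs2 : 2 ≤ s) (hs3 : s ≤ 3) (hc : 0 < c) (hC : 0 < C) (hD : 0 < D)
    (hξ : ∀ n, MemLp (ξ n) (ENNReal.ofReal s) P ∧ MemLp (ξ n) 2 P ∧ c ^ 2 ≤ ∫ ω, ξ n ω ^ 2 ∂P ∧
      ∫ ω, ξ n ω ^ 2 ∂P ≤ C ^ 2 ∧ ∫ ω, |ξ n ω| ^ s ∂P ≤ D)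
    (hL : S.secondDerivNorm ≠ ⊤) {K κ : ℝ} (hK0 : 0 ≤ K) (hκ0 : 0 ≤ κ)
    (hK : K ≤ κ * S.secondDerivNorm.toReal)
    (hT : ∀ (ξ : ℕ → Ω → ℝ) (σ : ℝ) (n : ℕ) (ω : Ω), 0 < σ →
        (κ * S.secondDerivNorm.toReal * σ * maxNoise ξ n ω ≤ 1 → ω ∈ S.staysInside ξ σ n) ∧
        (ω ∈ S.staysInside ξ σ n → ∀ m < n,
          |S.toFun (S.noisyOrbit ξ x σ m ω) - S.toFun (S.toFun^[m] x)
              - deriv S.toFun (S.toFun^[m] x) * (S.noisyOrbit ξ x σ m ω - S.toFun^[m] x)|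
            ≤ K * (S.noisyOrbit ξ x σ m ω - S.toFun^[m] x) ^ 2))
    {n : ℕ} (hn : 0 < n) {σ : ℝ} (hσ : 0 < σ)
    (hsmall : ENNReal.ofReal (S.lyapunovHat x n ^ 3 / √(Var[S.linearNoise ξ x n; P]))
        * S.secondDerivNorm * ENNReal.ofReal (momentNorm P s (maxNoise ξ n) ^ 2 * σ)
        ≤ ENNReal.ofReal (S.lyapunovRatio s x n ^ 2)) :
    P.real (S.goodEvent ξ x σ n)ᶜ
        ≤ (16 * (κ + 1) ^ 2 * C ^ 2 / c ^ 2 + 4 * (κ + 1)) * S.lyapunovRatio s x n ∧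
    ∀ z, |P.real {ω | (S.goodEvent ξ x σ n).indicator (S.normalizedNoise P ξ x σ n) ω ≤ z}
        - cdf (gaussianReal 0 1) z|
      ≤ (200 * (D / c ^ s) + 1 + (16 * (κ + 1) ^ 2 * C ^ 2 / c ^ 2 + 4 * (κ + 1)))
        * S.lyapunovRatio s x n := by
  have hΛ : 1 ≤ S.lyapunov 2 x n := S.one_le_lyapunov 2 x hn
  have hV : Var[S.linearNoise ξ x n; P] = ∑ j ∈ Finset.Icc 1 n,
      deriv (S.toFun^[n - j]) (S.toFun^[j] x) ^ 2 * ∫ ω, ξ j ω ^ 2 ∂P :=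
    S.variance_linearNoise hi (fun n => (hξ n).2.1) h0 x n
  have hVlow : c ^ 2 * S.lyapunov 2 x n ≤ Var[S.linearNoise ξ x n; P] :=
    S.sq_mul_lyapunov_le_variance hi (fun n => (hξ n).2.1) h0 (fun n => (hξ n).2.2.1) x n
  have hVup : Var[S.linearNoise ξ x n; P] ≤ C ^ 2 * S.lyapunov 2 x n := by
    rw [hV, lyapunov_two_eq, mul_comm, Finset.sum_mul]
    exact Finset.sum_le_sum fun j _ => mul_le_mul_of_nonneg_left (hξ j).2.2.2.1 (sq_nonneg _)
  have hBE := S.abs_cdf_linearNoise_sub_le hm hi h0 hs2 hs3 hc hD (fun n => (hξ n).2.1)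
    (fun n => (hξ n).1) (fun n => (hξ n).2.2.2.2) x hn hVlow
  have hV0 : 0 < Var[S.linearNoise ξ x n; P] := lt_of_lt_of_le (by positivity) hVlow
  set H := S.lyapunovHat x n with hH
  have hH1 : 1 ≤ H := S.one_le_lyapunovHat x n
  -- Since Λ_2 ≤ Λ̂², one factor Λ̂ in h absorbs the division by √Var. This compares the good-event
  -- threshold, with Λ̂², to h, with Λ̂³.
  have hsV : √(Var[S.linearNoise ξ x n; P]) ≤ C * H := by
    refine Real.sqrt_le_iff.2 ⟨by positivity, hVup.trans ?_⟩
    rw [mul_pow]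
    exact mul_le_mul_of_nonneg_left (S.lyapunov_two_le_lyapunovHat_sq x n) (sq_nonneg _)
  have hS0 : 0 < √(Var[S.linearNoise ξ x n; P]) := Real.sqrt_pos.2 hV0
  have hRpos := S.lyapunovRatio_pos s x hn
  have hR1 := S.lyapunovRatio_le_one x hs2 hn
  set R := S.lyapunovRatio s x n with hRdef
  set L := S.secondDerivNorm.toReal with hLdef
  have hL0 : 0 ≤ L := ENNReal.toReal_nonneg
  have hLe : S.secondDerivNorm = ENNReal.ofReal L := (ENNReal.ofReal_toReal hL).symm
  set N := momentNorm P s (maxNoise ξ n) with hN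
  set η := maxNoise ξ n with hη
  have hη0 : ∀ ω, 0 ≤ η ω := maxNoise_nonneg ξ n
  have hη2 : Integrable (fun ω => η ω ^ 2) P :=
    (memLp_maxNoise hm (fun n => (hξ n).2.1) n).integrable_sq
  have hηN : ∫ ω, η ω ^ 2 ∂P ≤ N ^ 2 :=
    integral_sq_le_momentNorm_sq hs2 (memLp_maxNoise hm (fun n => (hξ n).1) n)
  have hηc : c ^ 2 ≤ ∫ ω, η ω ^ 2 ∂P :=
    sq_le_integral_maxNoise_sq hm (fun n => (hξ n).2.1) (fun n => (hξ n).2.2.1) hn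
  set v := √(Var[S.linearNoise ξ x n; P]) with hv
  set h := L * σ * H ^ 3 / v with hh
  have hh0 : 0 ≤ h := by positivity
  have hhN : h * N ^ 2 ≤ R ^ 2 := by
    rw [hLe, ← ENNReal.ofReal_mul (by positivity), ← ENNReal.ofReal_mul (by positivity),
      ENNReal.ofReal_le_ofReal_iff (by positivity)] at hsmall
    refine le_trans (le_of_eq ?_) hsmall
    rw [hh]; ring
  have hhM : h * ∫ ω, η ω ^ 2 ∂P ≤ R ^ 2 :=
    (mul_le_mul_of_nonneg_left hηN hh0).trans hhN
  -- With `κ + 1`, the single condition qη ≤ 1 yields three things: the summand 1 gives the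
  -- threshold 1/4, the summand `κ` gives `staysInside`, and `K ≤ (κ + 1) * L` gives the smallness
  -- needed for the orbit estimate.
  set q := 4 * (κ + 1) * (L * σ * H ^ 2) with hq
  have hqle : q ≤ 4 * (κ + 1) * C * h := by
    have e : L * σ * H ^ 2 ≤ C * h := by
      have e1 : C * h = L * σ * H ^ 2 * (C * H / v) := by rw [hh]; ring
      rw [e1]
      exact le_mul_of_one_le_right (by positivity) ((one_le_div hS0).2 hsV)
    have := mul_le_mul_of_nonneg_left e (by positivity : 0 ≤ 4 * (κ + 1))
    rw [hq]; linarith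
  have hbad := measureReal_exceptional_le hη2 hh0 (by positivity : 0 ≤ κ + 1)
    (by positivity) hqle hc hRpos hR1 hηc hhM
  set E := {ω | 1 < q ^ 2 * η ω ^ 2} ∪ {ω | 1 < 4 * (κ + 1) * h / R * η ω ^ 2} with hE
  have hmem : ∀ ω ∉ E, q * η ω ≤ 1 ∧ 4 * (κ + 1) * h * η ω ^ 2 ≤ R := by
    intro ω hω
    simp only [hE, Set.mem_union, Set.mem_ofPred_eq, not_or, not_lt] at hω
    refine ⟨?_, ?_⟩
    · rw [← mul_pow] at hω
      exact (sq_le_one_iff₀ (mul_nonneg (by positivity) (hη0 ω))).1 hω.1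
    · have := hω.2
      rw [div_mul_eq_mul_div, div_le_one hRpos] at this
      exact this
  have hgood : ∀ ω ∉ E, ω ∈ S.goodEvent ξ x σ n := by
    intro ω hω
    have h1 := (hmem ω hω).1
    have hηω := hη0 ω
    refine ⟨?_, (hT ξ σ n ω hσ).1 ?_⟩
    · change S.secondDerivNorm * ENNReal.ofReal (σ * H ^ 2 * η ω) ≤ 1 / 4
      rw [hLe, ← ENNReal.ofReal_mul hL0]
      have e : (1 / 4 : ℝ≥0∞) = ENNReal.ofReal (1 / 4) := by
        rw [ENNReal.ofReal_div_of_pos (by norm_num)]; simp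
      rw [e]
      refine ENNReal.ofReal_le_ofReal ?_
      have : 0 ≤ κ * (L * (σ * H ^ 2 * η ω)) := by positivity
      have e2 : q * η ω = 4 * (κ * (L * (σ * H ^ 2 * η ω))) + 4 * (L * (σ * H ^ 2 * η ω)) := by
        rw [hq]; ring
      linarith
    · have e2 : q * η ω = 4 * κ * L * σ * η ω * H ^ 2 + 4 * (L * σ * H ^ 2 * η ω) := by
        rw [hq]; ring
      have e3 : 4 * κ * L * σ * η ω ≤ 4 * κ * L * σ * η ω * H ^ 2 :=
        le_mul_of_one_le_right (by positivity) (one_le_pow₀ hH1)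
      have e4 : 0 ≤ κ * L * σ * η ω := by positivity
      have e5 : 0 ≤ L * σ * H ^ 2 * η ω := by positivity
      change κ * L * σ * η ω ≤ 1
      linarith
  refine ⟨(measureReal_mono fun ω hω => ?_).trans hbad, fun z => ?_⟩
  · by_contra hω'
    exact hω (hgood ω hω')
  -- Off `E` the indicator equals one, and the quadratic orbit error divided by σ√Var is at most
  -- 4(κ+1)hη² ≤ R.
  · have hclose : ∀ ω ∉ E, |(S.goodEvent ξ x σ n).indicator (S.normalizedNoise P ξ x σ n) ω
        - S.linearNoise ξ x n ω / v| ≤ R := by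
      intro ω hω
      have hg := hgood ω hω
      obtain ⟨h1, h2⟩ := hmem ω hω
      have hηω := hη0 ω
      have hKs : 4 * K * σ * H ^ 2 * η ω ≤ q * η ω := by
        have : K * (4 * σ * H ^ 2 * η ω) ≤ (κ + 1) * L * (4 * σ * H ^ 2 * η ω) :=
          mul_le_mul_of_nonneg_right (by linarith) (by positivity)
        rw [hq]; linarith
      have hdev := S.abs_noisyOrbit_sub_le hx (ξ := ξ) (n := n) hσ.le hK0
        ((hT ξ σ n ω hσ).2 hg.2) (hKs.trans h1)
      rw [Set.indicator_of_mem hg]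
      have e : S.normalizedNoise P ξ x σ n ω - S.linearNoise ξ x n ω / v
          = (S.noisyOrbit ξ x σ n ω - S.toFun^[n] x - σ * S.linearNoise ξ x n ω) / (σ * v) := by
        unfold normalizedNoise
        rw [← hv]
        field_simp
      rw [e, abs_div, abs_of_pos (by positivity : 0 < σ * v), div_le_iff₀ (by positivity)]
      refine hdev.trans ?_
      have e1 : 4 * (κ + 1) * h * η ω ^ 2 * (σ * v)
          = 4 * ((κ + 1) * L) * σ ^ 2 * H ^ 3 * η ω ^ 2 := by
        rw [hh]; field_simp
      have e2 := mul_le_mul_of_nonneg_right h2 (by positivity : 0 ≤ σ * v)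
      rw [e1] at e2
      have e3 : K * (4 * σ ^ 2 * H ^ 3 * η ω ^ 2)
          ≤ (κ + 1) * L * (4 * σ ^ 2 * H ^ 3 * η ω ^ 2) :=
        mul_le_mul_of_nonneg_right (by linarith) (by positivity)
      change 4 * K * σ ^ 2 * H ^ 3 * η ω ^ 2 ≤ _
      linarith
    have := abs_measureReal_le_sub_le (z := z) hRpos.le hclose hBE
    linarith

end OneDimMap

/-! ### Conclusion along the sequence of times -/

theorem theorem2 {Ω : Type*} [MeasurableSpace Ω] (P : Measure Ω) [IsProbabilityMeasure P]
    (S : OneDimMap) (p : ℝ) (hp : 2 < p) (ξ : ℕ → Ω → ℝ) (hξ : IsNoise P ξ p)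
    (s : ℝ) (hs : s = min p 3) (x : ℝ) (hx : x ∈ S.domain) :
    ∃ A : ℝ, 0 < A ∧
      ∀ (n : ℕ → ℕ) (σ : ℕ → ℝ), (∀ k, 0 < n k) → StrictMono n → (∀ k, 0 < σ k) →
        Tendsto (fun k => S.lyapunovRatio p x (n k)) atTop (𝓝 0) →
        (∀ k, ENNReal.ofReal (S.lyapunovHat x (n k) ^ 3 / √(Var[S.linearNoise ξ x (n k); P]))
            * S.secondDerivNorm
            * ENNReal.ofReal (momentNorm P s (maxNoise ξ (n k)) ^ 2 * σ k)
          ≤ ENNReal.ofReal (S.lyapunovRatio s x (n k) ^ 2)) →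
        (∀ k, MeasurableSet (S.goodEvent ξ x (σ k) (n k))) ∧
        Tendsto (fun k => P (S.goodEvent ξ x (σ k) (n k))) atTop (𝓝 1) ∧
        ∀ (k : ℕ) (z : ℝ),
          |P.real {ω | (S.goodEvent ξ x (σ k) (n k)).indicator
              (S.normalizedNoise P ξ x (σ k) (n k)) ω ≤ z} - cdf (gaussianReal 0 1) z|
            ≤ A * S.lyapunovRatio s x (n k) := by
  have hs2 : 2 < s := by rw [hs]; exact lt_min hp (by norm_num)
  have hs3 : s ≤ 3 := hs.trans_le (min_le_right _ _)
  have hsp : s ≤ p := hs.trans_le (min_le_left _ _)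
  obtain ⟨c, C, D, hc, hC, hD, hb⟩ := hξ.exists_moment_bounds hs2 hsp
  -- The other two factors of the smallness hypothesis are positive, so an infinite ‖f''‖ makes its
  -- left side infinite and the hypothesis fails; any constant serves.
  by_cases hL : S.secondDerivNorm = ⊤
  · refine ⟨1, one_pos, fun n σ hn _ hσ _ hsmall => absurd (hsmall 0) ?_⟩
    have hV : 0 < Var[S.linearNoise ξ x (n 0); P] := by
      have h1 := S.one_le_lyapunov 2 x (hn 0)
      exact lt_of_lt_of_le (by positivity) (S.sq_mul_lyapunov_le_variance hξ.indep
        (fun n => (hb n).2.1) hξ.mean_zero (fun n => (hb n).2.2.1) x (n 0))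
    have hH := S.one_le_lyapunovHat x (n 0)
    have hN : 0 < momentNorm P s (maxNoise ξ (n 0)) ^ 2 :=
      (by positivity : 0 < c ^ 2).trans_le ((OneDimMap.sq_le_integral_maxNoise_sq hξ.measurable
        (fun n => (hb n).2.1) (fun n => (hb n).2.2.1) (hn 0)).trans
        (integral_sq_le_momentNorm_sq hs2.le
          (memLp_maxNoise hξ.measurable (fun n => (hb n).1) (n 0))))
    have hV' := Real.sqrt_pos.2 hV
    rw [hL, ENNReal.mul_top (ENNReal.ofReal_pos.2 (by positivity)).ne',
      ENNReal.top_mul (ENNReal.ofReal_pos.2 (mul_pos hN (hσ 0))).ne']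
    simp
  -- In the first alternative Λ_2 is bounded while Λ_p ≥ 1, so the ratio of order p cannot tend to
  -- 0.
  rcases S.bounded_lyapunov_or_taylor (Ω := Ω) hx hL with ⟨M, hM⟩ | ⟨K, κ, hK0, hκ0, hK, hT⟩
  · exact ⟨1, one_pos, fun n σ hn _ _ hlim _ => absurd hlim
      (S.not_tendsto_lyapunovRatio_of_bounded x (by linarith) hM hn)⟩
  have hcs : 0 < c ^ s := Real.rpow_pos_of_pos hc s
  refine ⟨200 * (D / c ^ s) + 1 + (16 * (κ + 1) ^ 2 * C ^ 2 / c ^ 2 + 4 * (κ + 1)),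
    by positivity, fun n σ hn _ hσ hlim hsmall => ?_⟩
  have key := fun k => S.goodEvent_and_berry_esseen hx hξ.measurable hξ.indep hξ.mean_zero hs2.le
    hs3 hc hC hD hb hL hK0 hκ0 hK hT (hn k) (hσ k) (hsmall k)
  have hmeas := fun k => S.measurableSet_goodEvent hξ.measurable x (σ k) (n k)
  refine ⟨hmeas, ?_, fun k z => (key k).2 z⟩
  have hlim' := S.tendsto_lyapunovRatio_min x hp hn hlim
  rw [← hs] at hlim'
  have hcompl : Tendsto (fun k => P.real (S.goodEvent ξ x (σ k) (n k))ᶜ) atTop (𝓝 0) := by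
    refine squeeze_zero (fun k => measureReal_nonneg) (fun k => (key k).1) ?_
    simpa using hlim'.const_mul (16 * (κ + 1) ^ 2 * C ^ 2 / c ^ 2 + 4 * (κ + 1))
  have hreal : Tendsto (fun k => P.real (S.goodEvent ξ x (σ k) (n k))) atTop (𝓝 1) := by
    have h := hcompl.const_sub 1
    rw [sub_zero] at h
    refine h.congr fun k => ?_
    rw [probReal_compl_eq_one_sub (hmeas k)]
    ring
  have h := ENNReal.tendsto_ofReal hreal
  rw [ENNReal.ofReal_one] at h
  exact h.congr fun k => ofReal_measureReal
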